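/- Let $S$ be an oriented compact pair of pants with boundary components $A_1,A_2,A_3$, each oriented opposite to the boundary orientation; indices are taken modulo $3$. Identify $S-\partial S$ with a three-puncture sphere $\Sigma$ with punctures $p_1,p_2,p_3$ corresponding to $A_1,A_2,A_3$, and decompose $\Sigma$ into two ideal triangles $T_+,T_-$ meeting along disjoint lines $B_1,B_2,B_3$, where $B_i$ goes from $p_{i-1}$ to $p_{i+1}$ and $p_1,p_2,p_3$ occur in this order clockwise around $T_+$. Let $\pi$ be a convex projective structure on $\Sigma$ (for instance the restriction of a convex projective structure with geodesic boundary on $S$), that is, one whose developing map is a homeomorphism from the universal cover $\widetilde\Sigma$ to an open convex domain $\Omega$ of an affine chart of $\mathbb{RP}^2$. Let $\rho\colon\pi_1(S)\to \mathrm{SL}_3(\mathbb R)$ be its monodromy, and suppose that each $\rho(A_i)$ has distinct positive eigenvalues $0<\lambda_i<\mu_i<\nu_i$. Put $\tau_i=\mu_i+\nu_i$. Let $\widetilde T_+$ be a lift of $T_+$ to $\widetilde\Sigma$, and let $\widetilde T_i$ be the lift of $T_-$ that is adjacent to $\widetilde T_+$ along a lift of $B_i$. Represent $A_1,A_2,A_3$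 by the elements of $\pi_1(S)$ that fix the ideal vertices of $\widetilde T_+$; thus $A_i\widetilde T_{i+1}=\widetilde T_{i-1}$. *Goldman's internal parameters.* Suppose that $\pi$ has been isotoped so that its developing map sends each lift of $T_\pm$ to a geometric triangle minus its vertices, each vertex being the repelling fixed point (the eigenspace for the smallest eigenvalue) of the monodromy of the corresponding boundary element. Let $\Delta_+,\Delta_1,\Delta_2,\Delta_3$ be the triangles corresponding to $\widetilde T_+,\widetilde T_1,\widetilde T_2,\widetilde T_3$. After a projective transformation, the vertices of $\Delta_+$ fixed by $\rho(A_1),\rho(A_2),\rho(A_3)$ are $[1,0,0]$, $[0,1,0]$, $[0,0,1]$, and the remaining vertices of $\Delta_1,\Delta_2,\Delta_3$ are $[-1,b_1,c_1]$, $[a_2,-1,c_2]$, $[a_3,b_3,-1]$ with all $a_i,b_i,c_i>0$. The internal parameters $s,t>0$ are defined by $t=\frac{a_2b_3}{a_3}$ and \begin{align*} b_3c_2&=1+\tau_1\sqrt{\tfrac{\lambda_1\lambda_3}{\lambda_2}}\,s+\tfrac{\lambda_3}{\lambda_2}s^2,\\ a_3c_1&=1+\tau_2\sqrt{\tfrac{\lambda_1\lambda_2}{\lambda_3}}\,s+\tfrac{\lambda_1}{\lambda_3}s^2,\\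 a_2b_1&=1+\tau_3\sqrt{\tfrac{\lambda_2\lambda_3}{\lambda_1}}\,s+\tfrac{\lambda_2}{\lambda_1}s^2 . \end{align*} *Fock–Goncharov invariants.* Let $F_i$ be the unstable flag of $\rho(A_i)$: its line $F_i^{(1)}$ is the $\lambda_i$-eigenspace and its plane $F_i^{(2)}$ is spanned by the $\lambda_i$- and $\mu_i$-eigenspaces. Let $F_i'$ be the unstable flag of the monodromy of the boundary element $A_{i+1}A_iA_{i+1}^{-1}$ fixing the third ideal vertex of $\widetilde T_i$ (the one not on the lift of $B_i$). For arbitrary non-zero $f_i^{(a)}\in\Lambda^a(F_i^{(a)})$ and $f_i^{\prime(a)}\in\Lambda^a(F_i^{\prime(a)})$, set \begin{align*} \tau_{111}(T_+)&=\log\left(\frac{f_1^{(2)}\wedge f_2^{(1)}}{f_2^{(1)}\wedge f_3^{(2)}}\,\frac{f_1^{(1)}\wedge f_3^{(2)}}{f_1^{(1)}\wedge f_2^{(2)}}\,\frac{f_2^{(2)}\wedge f_3^{(1)}}{f_1^{(2)}\wedge f_3^{(1)}}\right),\\ \sigma_1(B_i)&=\log\left(-\frac{f_{i+1}^{(1)}\wedge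 f_{i-1}^{(1)}\wedge f_i^{(1)}}{f_{i+1}^{(1)}\wedge f_{i-1}^{(1)}\wedge f_i^{\prime(1)}}\,\frac{f_{i-1}^{(2)}\wedge f_i^{\prime(1)}}{f_{i-1}^{(2)}\wedge f_i^{(1)}}\right),\\ \sigma_2(B_i)&=\log\left(-\frac{f_{i+1}^{(1)}\wedge f_{i-1}^{(1)}\wedge f_i^{\prime(1)}}{f_{i+1}^{(1)}\wedge f_{i-1}^{(1)}\wedge f_i^{(1)}}\,\frac{f_{i+1}^{(2)}\wedge f_i^{(1)}}{f_{i+1}^{(2)}\wedge f_i^{\prime(1)}}\right). \end{align*} Then the quantities inside the logarithms are positive, the internal parameters $s$ and $t$ exist and are unique, and they are equal to \begin{align*} s&=\mathrm e^{\frac16\left(\sigma_1(B_1)+\sigma_1(B_2)+\sigma_1(B_3)-\sigma_2(B_1)-\sigma_2(B_2)-\sigma_2(B_3)\right)},\\ t&=\mathrm e^{-\tau_{111}(T_+)}\left(\mathrm e^{-\sigma_2(B_2)}+1\right)\left(\mathrm e^{-\sigma_2(B_3)}+1\right)\left(\mathrm e^{\sigma_1(B_3)}+1\right)^{-1}. \end{align*}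 -/

import Mathlib

open Filter Topology
open scoped LinearAlgebra.Projectivization

noncomputable section

/-! ### The real projective plane -/

/-- The real projective plane, as the set of lines through the origin of `ℝ³`. -/
abbrev RP2 : Type := ℙ ℝ (Fin 3 → ℝ)

/-- The quotient topology of the projective plane. -/
instance RP2.instTopologicalSpace : TopologicalSpace RP2 :=
  TopologicalSpace.coinduced
    (fun v : {v : Fin 3 → ℝ // v ≠ 0} => Projectivization.mk ℝ v.1 v.2) inferInstance

/-- `SL₃(ℝ) = PGL₃(ℝ)`, the group of projective transformations. It acts on `ℝ³` by
matrix-vector multiplication, and on `RP2` by the induced action. -/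
abbrev SL3 : Type := Matrix.SpecialLinearGroup (Fin 3) ℝ

/-- The vector `u` consists of homogeneous coordinates of the point `q`, that is `q = [u]`. -/
def IsHomCoord (u : Fin 3 → ℝ) (q : RP2) : Prop :=
  ∃ hu : u ≠ 0, Projectivization.mk ℝ u hu = q

/-- A convex domain of the projective plane: a non-empty open subset that is contained in some
affine chart `{f = 1}` and is convex in that chart. -/
def IsConvexDomain (Ω : Set RP2) : Prop :=
  IsOpen Ω ∧ Ω.Nonempty ∧
    ∃ (f : (Fin 3 → ℝ) →ₗ[ℝ] ℝ) (K : Set (Fin 3 → ℝ)),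
      Convex ℝ K ∧ (∀ v ∈ K, f v = 1) ∧ Ω = {q | ∃ v ∈ K, IsHomCoord v q}

/-- Three non-collinear points of the projective plane, with chosen homogeneous coordinates. The
signs of the coordinates single out one of the four triangles that have these vertices. -/
structure ProjTriangle where
  /-- homogeneous coordinates of the three vertices -/
  vert : Fin 3 → (Fin 3 → ℝ)
  indep : LinearIndependent ℝ vert

namespace ProjTriangle

/-- The `i`-th vertex, as a point of the projective plane. -/
def vertex (Δ : ProjTriangle) (i : Fin 3) : RP2 :=
  Projectivization.mk ℝ (Δ.vert i) (Δ.indep.ne_zero i)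

/-- The closed triangle minus its three vertices. -/
def minusVertices (Δ : ProjTriangle) : Set RP2 :=
  {q | ∃ c : Fin 3 → ℝ, (∀ i, 0 ≤ c i) ∧ (∃ i j, i ≠ j ∧ 0 < c i ∧ 0 < c j) ∧
    IsHomCoord (∑ i, c i • Δ.vert i) q}

/-- The open side opposite to the `i`-th vertex. -/
def side (Δ : ProjTriangle) (i : Fin 3) : Set RP2 :=
  {q | ∃ α β : ℝ, 0 < α ∧ 0 < β ∧
    IsHomCoord (α • Δ.vert (i - 1) + β • Δ.vert (i + 1)) q}

end ProjTriangle

/-! ### The pair of pants and its decomposition into two ideal triangles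

The interior of the pair of pants is the three-puncture sphere. It is realized as `ℂ ∖ {0, 1}`,
with its two ideal triangles the closed upper and lower half-planes. The indices `1, 2, 3` are
the elements `0, 1, 2` of `Fin 3`, so that index arithmetic is modulo 3. The punctures number
`0, 1, 2` are `1`, `0`, `∞`: they occur in this order clockwise around the upper half-plane. The
line number `i` goes from the puncture `i - 1` to the puncture `i + 1`. -/

/-- The three-puncture sphere, interior of the pair of pants. -/
abbrev Pants : Type := {z : ℂ // z ≠ 0 ∧ z ≠ 1}

namespace Pants

/-- The ideal triangle `T₊`. -/
def Tplus : Set Pants := {z | 0 ≤ z.1.im}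

/-- The ideal triangle `T₋`. -/
def Tminus : Set Pants := {z | z.1.im ≤ 0}

/-- The lines along which the two triangles meet. -/
def B : Fin 3 → Set Pants :=
  ![{z | z.1.im = 0 ∧ z.1.re < 0},
    {z | z.1.im = 0 ∧ 1 < z.1.re},
    {z | z.1.im = 0 ∧ 0 < z.1.re ∧ z.1.re < 1}]

/-- The neighborhoods of the three punctures. -/
def puncture : Fin 3 → Filter Pants :=
  ![comap Subtype.val (𝓝 (1 : ℂ)),
    comap Subtype.val (𝓝 (0 : ℂ)),
    comap Subtype.val (Bornology.cobounded ℂ)]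

theorem B_subset_Tplus (i : Fin 3) : B i ⊆ Tplus := by
  intro z hz
  fin_cases i <;> exact le_of_eq hz.1.symm

theorem B_subset_Tminus (i : Fin 3) : B i ⊆ Tminus := by
  intro z hz
  fin_cases i <;> exact le_of_eq hz.1

end Pants

/-! ### Projective structures, developing maps and monodromy -/

/-- A projective structure on a surface `M` (without boundary): an atlas of charts with values in
the projective plane, whose coordinate changes are locally projective transformations. -/
structure ProjectiveStructure (M : Type*) [TopologicalSpace M] where
  atlas : Set (OpenPartialHomeomorph M RP2)
  cover : ∀ x, ∃ φ ∈ atlas, x ∈ φ.source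
  compatible : ∀ φ ∈ atlas, ∀ ψ ∈ atlas, ∀ x, x ∈ φ.source → x ∈ ψ.source →
    ∃ g : SL3, ∀ᶠ y in 𝓝 x, ψ y = g • φ y

/-- The group of deck transformations of a covering `p : X → M`. When `X` is simply connected
this is the fundamental group of `M`. -/
def Deck {X M : Type*} [TopologicalSpace X] (p : X → M) : Subgroup (X ≃ₜ X) where
  carrier := {γ | ∀ x, p (γ x) = p x}
  mul_mem' := fun {a b} ha hb x => (ha (b x)).trans (hb x)
  one_mem' := fun _ => rfl
  inv_mem' := fun {a} ha x => by
    have h := ha (a⁻¹ x)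
    rw [← h]
    exact congrArg p (a.apply_symm_apply x)

/-- A developing map of the projective structure `π`, defined on the covering `p : X → M`, with
its monodromy homomorphism. -/
structure Development {X M : Type*} [TopologicalSpace X] [TopologicalSpace M]
    (π : ProjectiveStructure M) (p : X → M) where
  /-- the developing map -/
  dev : X → RP2
  /-- the monodromy homomorphism -/
  ρ : Deck p →* SL3
  projective : ∀ φ ∈ π.atlas, ∀ x, p x ∈ φ.source →
    ∃ g : SL3, ∀ᶠ y in 𝓝 x, dev y = g • φ (p y)
  equivariant : ∀ (γ : Deck p) (x : X), dev (γ.1 x) = ρ γ • dev x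

/-- The developing map is a homeomorphism from the universal cover to a convex domain. -/
def Development.IsConvex {X M : Type*} [TopologicalSpace X] [TopologicalSpace M]
    {π : ProjectiveStructure M} {p : X → M} (D : Development π p) : Prop :=
  IsEmbedding D.dev ∧ IsConvexDomain (Set.range D.dev)

/-! ### Lifts of the triangles -/

/-- A lift `T̃₊` of the triangle `T₊` to the covering, and the three lifts `T̃ᵢ` of `T₋` that touch
`T̃₊` along its sides corresponding to `Bᵢ`. Lifts are given as continuous sections. -/
structure TriangleLifts {X : Type*} [TopologicalSpace X] (p : X → Pants) where
  plus : Pants.Tplus → X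
  minus : Fin 3 → Pants.Tminus → X
  continuous_plus : Continuous plus
  continuous_minus : ∀ i, Continuous (minus i)
  p_plus : ∀ z, p (plus z) = z
  p_minus : ∀ i z, p (minus i z) = z
  adjacent : ∀ i z (hz : z ∈ Pants.B i),
    minus i ⟨z, Pants.B_subset_Tminus i hz⟩ = plus ⟨z, Pants.B_subset_Tplus i hz⟩

/-- The deck transformations `Aᵢ` represented by the boundary components of the pair of pants that
go around the ends of `T̃₊`: around its end at the `i`-th puncture, `Aᵢ` sends `T̃ᵢ₊₁` to `T̃ᵢ₋₁`.
It is the class of the loop that turns once, counterclockwise, around the `i`-th puncture (that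
is, opposite to the boundary orientation): it crosses `Bᵢ₊₁` from `T₋` to `T₊`, and then `Bᵢ₋₁`
from `T₊` to `T₋`. -/
def TriangleLifts.AreBoundaryElements {X : Type*} [TopologicalSpace X] {p : X → Pants}
    (L : TriangleLifts p) (A : Fin 3 → Deck p) : Prop :=
  ∀ i z, (A i).1 (L.minus (i + 1) z) = L.minus (i - 1) z

/-! ### Goldman's parameters -/

/-- `g` has the eigenvalues `0 < l < m < n`. -/
def HasEigenvalues (g : SL3) (l m n : ℝ) : Prop :=
  0 < l ∧ l < m ∧ m < n ∧
    g.1.charpoly = (Polynomial.X - Polynomial.C l) * (Polynomial.X - Polynomial.C m) *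
      (Polynomial.X - Polynomial.C n)

/-- The map `h` from one of the two ideal triangles, `T`, to the projective plane sends `T` onto
the triangle `Δ` minus its vertices, the line `Bᵢ` onto the side opposite to the `i`-th vertex, and
the end of `T` at the `i`-th puncture to the `i`-th vertex. -/
def IsStraightOn (T : Set Pants) (h : T → RP2) (Δ : ProjTriangle) : Prop :=
  Set.range h = Δ.minusVertices ∧
    (∀ i, h '' {z | z.1 ∈ Pants.B i} = Δ.side i) ∧
    ∀ i, Tendsto h (comap Subtype.val (Pants.puncture i)) (𝓝 (Δ.vertex i))

/-- An isotopy of the projective structure after which the developing map sends the lifts of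
`T₊` and `T₋` to geometric triangles minus their vertices, in such a way that the vertices are the
repelling fixed points of the monodromy of the corresponding boundary elements, i.e. their
eigenspaces for the smallest eigenvalues `lam i`.

The isotopy is given by the lift `h` to the universal cover of a homeomorphism of the surface that
is isotopic to the identity; such a lift commutes with the deck transformations. By equivariance
the condition for all lifts of `T₊` and `T₋` amounts to that for the four lifts in `L`. -/
structure GoldmanPosition {X : Type*} [TopologicalSpace X] {p : X → Pants}
    {π : ProjectiveStructure Pants} (D : Development π p) (L : TriangleLifts p)
    (A : Fin 3 → Deck p) (lam : Fin 3 → ℝ) where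
  h : X ≃ₜ X
  commutes : ∀ (γ : Deck p) (x : X), h (γ.1 x) = γ.1 (h x)
  /-- the triangle `Δ₊` -/
  Δplus : ProjTriangle
  /-- the triangles `Δ₁`, `Δ₂`, `Δ₃` -/
  Δ : Fin 3 → ProjTriangle
  straight_plus : IsStraightOn Pants.Tplus (fun z => D.dev (h (L.plus z))) Δplus
  straight_minus : ∀ i, IsStraightOn Pants.Tminus (fun z => D.dev (h (L.minus i z))) (Δ i)
  repelling : ∀ i, D.ρ (A i) • Δplus.vert i = lam i • Δplus.vert i

/-- `s` and `t` are the internal parameters: after a projective transformation `g`, the vertices of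
`Δ₊` are `[1,0,0]`, `[0,1,0]`, `[0,0,1]` and the remaining vertices of `Δ₁`, `Δ₂`, `Δ₃` are
`[-1,b₁,c₁]`, `[a₂,-1,c₂]`, `[a₃,b₃,-1]` with positive `aᵢ`, `bᵢ`, `cᵢ`, and `s`, `t > 0` satisfy
Goldman's four equations. Here `lam i` is the smallest eigenvalue of the monodromy of the `i`-th
boundary component and `tau i` is the sum of the other two. -/
def AreInternalParameters (Δplus : ProjTriangle) (Δ : Fin 3 → ProjTriangle)
    (lam tau : Fin 3 → ℝ) (s t : ℝ) : Prop :=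
  ∃ (g : SL3) (b₁ c₁ a₂ c₂ a₃ b₃ : ℝ),
    0 < b₁ ∧ 0 < c₁ ∧ 0 < a₂ ∧ 0 < c₂ ∧ 0 < a₃ ∧ 0 < b₃ ∧
    IsHomCoord ![1, 0, 0] (g • Δplus.vertex 0) ∧
    IsHomCoord ![0, 1, 0] (g • Δplus.vertex 1) ∧
    IsHomCoord ![0, 0, 1] (g • Δplus.vertex 2) ∧
    IsHomCoord ![-1, b₁, c₁] (g • (Δ 0).vertex 0) ∧
    IsHomCoord ![a₂, -1, c₂] (g • (Δ 1).vertex 1) ∧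
    IsHomCoord ![a₃, b₃, -1] (g • (Δ 2).vertex 2) ∧
    0 < s ∧ 0 < t ∧
    t = a₂ * b₃ / a₃ ∧
    b₃ * c₂ = 1 + tau 0 * √(lam 0 * lam 2 / lam 1) * s + lam 2 / lam 1 * s ^ 2 ∧
    a₃ * c₁ = 1 + tau 1 * √(lam 0 * lam 1 / lam 2) * s + lam 0 / lam 2 * s ^ 2 ∧
    a₂ * b₁ = 1 + tau 2 * √(lam 1 * lam 2 / lam 0) * s + lam 1 / lam 0 * s ^ 2

/-! ### Flags and the Fock-Goncharov invariants -/

/-- A flag in `ℝ³`. -/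
structure Flag3 where
  line : Submodule ℝ (Fin 3 → ℝ)
  plane : Submodule ℝ (Fin 3 → ℝ)
  line_le_plane : line ≤ plane
  finrank_line : Module.finrank ℝ line = 1
  finrank_plane : Module.finrank ℝ plane = 2

/-- `F` is the unstable flag of `g`: its line is the eigenspace for the lowest eigenvalue `l`, and
its plane is generated by this line and the eigenspace for the second lowest eigenvalue `m`. -/
def Flag3.IsUnstable (F : Flag3) (g : SL3) (l m : ℝ) : Prop :=
  F.line = Module.End.eigenspace (Matrix.toLin' g.1) l ∧
    F.plane = F.line ⊔ Module.End.eigenspace (Matrix.toLin' g.1) m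

/-- Vectors `x`, `y` that give non-zero elements `f⁽¹⁾ = x` and `f⁽²⁾ = x ∧ y` of the exterior
powers `Λ¹` of the line and `Λ²` of the plane of the flag `F`. Every pair of non-zero elements of
these two one-dimensional spaces is of this form. -/
def Flag3.IsFrame (F : Flag3) (x y : Fin 3 → ℝ) : Prop :=
  Submodule.span ℝ {x} = F.line ∧ Submodule.span ℝ {x, y} = F.plane

/-- The wedge product `u ∧ v ∧ w`, as a multiple of the standard generator of `Λ³(ℝ³)`. -/
def wedge (u v w : Fin 3 → ℝ) : ℝ := Matrix.det (Matrix.of ![u, v, w])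

/-- The triple ratio whose logarithm is the triangle invariant `τ₁₁₁(T₊)`, for
`fᵢ⁽¹⁾ = x i` and `fᵢ⁽²⁾ = x i ∧ y i`. -/
def tripleRatio (x y : Fin 3 → (Fin 3 → ℝ)) : ℝ :=
  wedge (x 0) (y 0) (x 1) / wedge (x 1) (x 2) (y 2) *
    (wedge (x 0) (x 2) (y 2) / wedge (x 0) (x 1) (y 1)) *
    (wedge (x 1) (y 1) (x 2) / wedge (x 0) (y 0) (x 2))

/-- The quantity whose logarithm is the shear invariant `σ₁(Bᵢ)`, where moreover
`fᵢ'⁽¹⁾ = x' i`. -/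
def shearRatio₁ (x y x' : Fin 3 → (Fin 3 → ℝ)) (i : Fin 3) : ℝ :=
  -(wedge (x (i + 1)) (x (i - 1)) (x i) / wedge (x (i + 1)) (x (i - 1)) (x' i) *
    (wedge (x (i - 1)) (y (i - 1)) (x' i) / wedge (x (i - 1)) (y (i - 1)) (x i)))

/-- The quantity whose logarithm is the shear invariant `σ₂(Bᵢ)`. -/
def shearRatio₂ (x y x' : Fin 3 → (Fin 3 → ℝ)) (i : Fin 3) : ℝ :=
  -(wedge (x (i + 1)) (x (i - 1)) (x' i) / wedge (x (i + 1)) (x (i - 1)) (x i) *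
    (wedge (x (i + 1)) (y (i + 1)) (x i) / wedge (x (i + 1)) (y (i + 1)) (x' i)))

/-- The triangle invariant `τ₁₁₁(T₊)`. -/
def tau111 (x y : Fin 3 → (Fin 3 → ℝ)) : ℝ := Real.log (tripleRatio x y)

/-- The shear invariant `σ₁(Bᵢ)`. -/
def sigma₁ (x y x' : Fin 3 → (Fin 3 → ℝ)) (i : Fin 3) : ℝ := Real.log (shearRatio₁ x y x' i)

/-- The shear invariant `σ₂(Bᵢ)`. -/
def sigma₂ (x y x' : Fin 3 → (Fin 3 → ℝ)) (i : Fin 3) : ℝ := Real.log (shearRatio₂ x y x' i)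

end

/-! ### Homogeneous coordinates and the topology of the projective plane -/

/-! Lift the four triangles to one closed half-cone over the domain. This gives vectors E_i for the
vertices of Δ₊ and Q_i = a_i E_{i+1} − E_i + b_i E_{i−1} for the outer vertices. The monodromy M_i
of A_i scales E_i by λ_i, sends E_{i−1} to β_i Q_{i−1} and Q_{i+1} to γ_i E_{i+1}. Convexity of the
domain and positivity of the eigenvalues make all of a, b, β, γ positive (`coord_signs`,
`IsConeOver.smul_mem_of_hasEigenvalues`, assembled in `GoldmanPosition.exists_pantsFrame`). The rest
is linear algebra.

The linear form f_i⁽²⁾ ∧ · vanishes at E_i and is multiplied by ν_i when composed with M_i.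
Evaluating it at Q_{i±1} in two ways gives its ratio between E_{i+1} and E_{i−1} as both a_{i+1}/(1
+ γ_i/ν_i) and (1 + ν_i/β_i)/b_{i−1}. The triple ratio is the product of these three ratios, and the
shears satisfy e^{σ₁(B_i)} = γ_{i−1}/ν_{i−1}, e^{σ₂(B_i)} = β_{i+1}/ν_{i+1}; the formula for t
follows.

Comparing the two ratios, b_{i−1}a_{i+1} = (1 + γ_i/ν_i)(1 + ν_i/β_i). Since det M_i = 1, λ_iβ_iγ_i
= 1 = λ_iμ_iν_i, hence γ_i/ν_i = μ_i/β_i and the product is 1 + (μ_i+ν_i)/β_i + μ_iν_i/β_i². With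
the relation A_{i+1}A_iA_{i−1} = 1, the number s defined by s⁶ = ∏ γ_i/β_i satisfies 1/β_i =
√(λ_iλ_{i−1}/λ_{i+1}) s for every i (`inv_beta_eq`), which turns these identities into Goldman's
equations. Uniqueness of s holds because the quadratics are injective on positive numbers. -/

theorem IsHomCoord.exists_smul_eq {u v : Fin 3 → ℝ} {q : RP2} (hu : IsHomCoord u q)
    (hv : IsHomCoord v q) : ∃ r : ℝ, r ≠ 0 ∧ u = r • v := by
  obtain ⟨hu0, hu⟩ := hu
  obtain ⟨hv0, hv⟩ := hv
  obtain ⟨a, ha⟩ := (Projectivization.mk_eq_mk_iff' ℝ u v hu0 hv0).1 (hu.trans hv.symm)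
  refine ⟨a, ?_, ha.symm⟩
  rintro rfl
  exact hu0 (by rw [← ha, zero_smul])

theorem IsHomCoord.mapsTo {u : Fin 3 → ℝ} {q : RP2} (hu : IsHomCoord u q) (g : SL3) :
    IsHomCoord (g • u) (g • q) := by
  obtain ⟨hu0, rfl⟩ := hu
  exact ⟨_, (Projectivization.smul_mk g hu0).symm⟩

theorem IsHomCoord.rescale {u : Fin 3 → ℝ} {q : RP2} (hu : IsHomCoord u q) {r : ℝ} (hr : r ≠ 0) :
    IsHomCoord (r • u) q := by
  obtain ⟨hu0, rfl⟩ := hu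
  exact ⟨smul_ne_zero hr hu0, (Projectivization.mk_eq_mk_iff' ℝ _ _ _ _).2 ⟨r, rfl⟩⟩

theorem IsHomCoord.unique {u : Fin 3 → ℝ} {q q' : RP2} (h : IsHomCoord u q)
    (h' : IsHomCoord u q') : q = q' := by
  obtain ⟨_, rfl⟩ := h
  obtain ⟨_, rfl⟩ := h'
  rfl

theorem ProjTriangle.isHomCoord_vertex (Δ : ProjTriangle) (i : Fin 3) :
    IsHomCoord (Δ.vert i) (Δ.vertex i) := ⟨_, rfl⟩

/-- The points of the projective plane where one linear form dominates another. -/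
def RP2.dominated (φ ψ : (Fin 3 → ℝ) →ₗ[ℝ] ℝ) : Set RP2 :=
  {q | ∀ u, IsHomCoord u q → |φ u| < |ψ u|}

theorem RP2.mk_mem_dominated {φ ψ : (Fin 3 → ℝ) →ₗ[ℝ] ℝ} {u : Fin 3 → ℝ} (hu : u ≠ 0) :
    Projectivization.mk ℝ u hu ∈ RP2.dominated φ ψ ↔ |φ u| < |ψ u| := by
  refine ⟨fun h => h u ⟨hu, rfl⟩, fun h v hv => ?_⟩
  obtain ⟨r, hr, rfl⟩ := hv.exists_smul_eq ⟨hu, rfl⟩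
  simp only [map_smul, smul_eq_mul, abs_mul]
  exact mul_lt_mul_of_pos_left h (abs_pos.2 hr)

theorem RP2.isOpen_dominated (φ ψ : (Fin 3 → ℝ) →ₗ[ℝ] ℝ) : IsOpen (RP2.dominated φ ψ) := by
  refine isOpen_coinduced.2 ?_
  have : (fun v : {v : Fin 3 → ℝ // v ≠ 0} => (Projectivization.mk ℝ v.1 v.2 : RP2)) ⁻¹'
      RP2.dominated φ ψ = {v | |φ v.1| < |ψ v.1|} := by
    ext v
    exact RP2.mk_mem_dominated v.2
  rw [this]
  have hφ : Continuous φ := φ.continuous_of_finiteDimensional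
  have hψ : Continuous ψ := ψ.continuous_of_finiteDimensional
  exact isOpen_lt (by fun_prop) (by fun_prop)

/-- Distinct points have independent representatives, so two linear forms take the values (1,0) and
(0,1) on them; the sets where one form dominates the other separate the points. Uniqueness of limits
is what identifies the vertices of neighboring triangles later. -/
instance RP2.t2Space : T2Space RP2 := by
  refine ⟨fun a b => ?_⟩
  induction a using Projectivization.ind with | h u hu => ?_
  induction b using Projectivization.ind with | h v hv => ?_
  intro hne
  have hli : LinearIndependent ℝ ![u, v] := by
    rw [linearIndependent_fin2]
    refine ⟨hv, fun a ha => hne ?_⟩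
    exact (Projectivization.mk_eq_mk_iff' ℝ _ _ _ _).2 ⟨a, ha⟩
  obtain ⟨F, hF⟩ := (Fintype.linearCombination ℝ ![u, v]).exists_leftInverse_of_injective
    (LinearMap.ker_eq_bot.2 hli.fintypeLinearCombination_injective)
  have h0 : F u = Pi.single 0 1 := by
    have := LinearMap.congr_fun hF (Pi.single 0 1)
    simpa [Fintype.linearCombination_apply_single] using this
  have h1 : F v = Pi.single 1 1 := by
    have := LinearMap.congr_fun hF (Pi.single 1 1)
    simpa [Fintype.linearCombination_apply_single] using this
  let φ : (Fin 3 → ℝ) →ₗ[ℝ] ℝ := LinearMap.proj 0 ∘ₗ F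
  let ψ : (Fin 3 → ℝ) →ₗ[ℝ] ℝ := LinearMap.proj 1 ∘ₗ F
  refine ⟨RP2.dominated ψ φ, RP2.dominated φ ψ, RP2.isOpen_dominated _ _,
    RP2.isOpen_dominated _ _, (RP2.mk_mem_dominated hu).2 ?_, (RP2.mk_mem_dominated hv).2 ?_, ?_⟩
  · simp [φ, ψ, h0]
  · simp [φ, ψ, h1]
  · rw [Set.disjoint_left]
    intro q h h'
    induction q using Projectivization.ind with | h w hw => ?_
    exact lt_asymm (h w ⟨hw, rfl⟩) (h' w ⟨hw, rfl⟩)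

theorem RP2.continuous_smul (g : SL3) : Continuous (fun q : RP2 => g • q) := by
  refine continuous_coinduced_dom.2 ?_
  have hg (v : {v : Fin 3 → ℝ // v ≠ 0}) : g • v.1 ≠ 0 := (smul_ne_zero_iff_ne g).2 v.2
  have : Continuous (fun v : {v : Fin 3 → ℝ // v ≠ 0} =>
      (⟨g • v.1, hg v⟩ : {v : Fin 3 → ℝ // v ≠ 0})) := by
    refine Continuous.subtype_mk ?_ _
    change Continuous fun v : {v : Fin 3 → ℝ // v ≠ 0} => g.1.mulVec v.1
    fun_prop
  exact continuous_coinduced_rng.comp this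

/-! ### The cone over a convex domain -/

/-- `C` is one of the two open half-cones over the domain `Ω`, namely that where the linear form
`f` is positive. -/
structure IsConeOver (C : Set (Fin 3 → ℝ)) (f : (Fin 3 → ℝ) →ₗ[ℝ] ℝ) (Ω : Set RP2) : Prop where
  pos : ∀ v ∈ C, 0 < f v
  smul_mem : ∀ v ∈ C, ∀ r : ℝ, 0 < r → r • v ∈ C
  add_mem : ∀ v ∈ C, ∀ w ∈ C, v + w ∈ C
  mem_or : ∀ q ∈ Ω, ∀ v, IsHomCoord v q → v ∈ C ∨ -v ∈ C
  exists_mem : ∀ v ∈ C, ∃ q ∈ Ω, IsHomCoord v q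

theorem IsConvexDomain.exists_isConeOver {Ω : Set RP2} (h : IsConvexDomain Ω) :
    ∃ C f, IsConeOver C f Ω := by
  obtain ⟨-, -, f, K, hK, hf, rfl⟩ := h
  refine ⟨{v | ∃ r : ℝ, 0 < r ∧ ∃ k ∈ K, v = r • k}, f, ?_, ?_, ?_, ?_, ?_⟩
  · rintro _ ⟨r, hr, k, hk, rfl⟩
    simpa [hf k hk] using hr
  · rintro _ ⟨r, hr, k, hk, rfl⟩ s hs
    exact ⟨s * r, mul_pos hs hr, k, hk, by rw [mul_smul]⟩
  · rintro _ ⟨r, hr, k, hk, rfl⟩ _ ⟨s, hs, l, hl, rfl⟩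
    refine ⟨r + s, add_pos hr hs, (r / (r + s)) • k + (s / (r + s)) • l,
      hK hk hl (by positivity) (by positivity) (by field_simp), ?_⟩
    rw [smul_add, smul_smul, smul_smul, mul_div_cancel₀ _ (by positivity),
      mul_div_cancel₀ _ (by positivity)]
  · rintro q ⟨k, hk, hkq⟩ v hv
    obtain ⟨r, hr, rfl⟩ := hv.exists_smul_eq hkq
    rcases lt_or_gt_of_ne hr with h | h
    · exact Or.inr ⟨-r, neg_pos.2 h, k, hk, by rw [neg_smul]⟩
    · exact Or.inl ⟨r, h, k, hk, rfl⟩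
  · rintro _ ⟨r, hr, k, hk, rfl⟩
    have hk0 : k ≠ 0 := by
      rintro rfl
      simpa using hf _ hk
    exact ⟨_, ⟨k, hk, hk0, rfl⟩, IsHomCoord.rescale ⟨hk0, rfl⟩ hr.ne'⟩

namespace IsConeOver

variable {C : Set (Fin 3 → ℝ)} {f : (Fin 3 → ℝ) →ₗ[ℝ] ℝ} {Ω : Set RP2}

theorem mem_of_isHomCoord (hC : IsConeOver C f Ω) {v : Fin 3 → ℝ} (hv : v ∈ C) {q : RP2}
    (hq : IsHomCoord v q) : q ∈ Ω := by
  obtain ⟨q', hq', h⟩ := hC.exists_mem v hv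
  rwa [hq.unique h]

/-- A convex set of vectors all of which represent points of the domain lies on one side. -/
theorem subset_or_neg_subset (hC : IsConeOver C f Ω) {S : Set (Fin 3 → ℝ)} (hS : Convex ℝ S)
    (h : ∀ v ∈ S, v ∈ C ∨ -v ∈ C) : (∀ v ∈ S, v ∈ C) ∨ (∀ v ∈ S, -v ∈ C) := by
  by_contra! hcon
  obtain ⟨⟨v, hvS, hv⟩, w, hwS, hw⟩ := hcon
  have hv' := hC.pos _ ((h v hvS).resolve_left hv)
  have hw' := hC.pos _ ((h w hwS).resolve_right hw)
  rw [map_neg] at hv'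
  -- The point of the segment where `f` vanishes, which neither half-cone contains.
  have hmem := hS hvS hwS (a := f w / (f w - f v)) (b := -f v / (f w - f v))
    (div_nonneg hw'.le (by linarith)) (div_nonneg hv'.le (by linarith))
    (by rw [← add_div]; exact div_self (by linarith))
  have hz : f ((f w / (f w - f v)) • v + (-f v / (f w - f v)) • w) = 0 := by
    simp only [map_add, map_smul, smul_eq_mul]
    ring
  rcases h _ hmem with h1 | h1
  · exact (hC.pos _ h1).ne' hz
  · have := hC.pos _ h1
    rw [map_neg, hz] at this
    simp at this

theorem convex (hC : IsConeOver C f Ω) : Convex ℝ C := by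
  intro v hv w hw a b ha hb hab
  rcases ha.eq_or_lt with rfl | ha
  · obtain rfl : b = 1 := by linarith
    simpa using hw
  rcases hb.eq_or_lt with rfl | hb
  · obtain rfl : a = 1 := by linarith
    simpa using hv
  exact hC.add_mem _ (hC.smul_mem _ hv _ ha) _ (hC.smul_mem _ hw _ hb)

end IsConeOver

/-! ### Matrices with three positive eigenvalues -/

theorem HasEigenvalues.charpoly_eq {g : SL3} {l m n : ℝ} (h : HasEigenvalues g l m n) :
    g.1.charpoly = Polynomial.X ^ 3 - Polynomial.C (l + m + n) * Polynomial.X ^ 2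
      + Polynomial.C (l * m + l * n + m * n) * Polynomial.X - Polynomial.C (l * m * n) := by
  rw [h.2.2.2]
  simp only [map_add, map_mul]
  ring

theorem HasEigenvalues.mul_eq_one {g : SL3} {l m n : ℝ} (h : HasEigenvalues g l m n) :
    l * m * n = 1 := by
  have h1 := Matrix.det_eq_sign_charpoly_coeff g.1
  rw [g.2, h.charpoly_eq] at h1
  simp [Polynomial.coeff_X_pow, Polynomial.coeff_C] at h1
  linarith

theorem HasEigenvalues.ne_one {g : SL3} {l m n : ℝ} (h : HasEigenvalues g l m n) : g ≠ 1 := by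
  rintro rfl
  have h1 : (1 : Matrix (Fin 3) (Fin 3) ℝ).charpoly = _ := h.2.2.2
  rw [Matrix.charpoly_one] at h1
  have hl := congrArg (Polynomial.eval l) h1
  have hm := congrArg (Polynomial.eval m) h1
  simp at hl hm
  have := h.2.1
  linarith

theorem HasEigenvalues.cayley_hamilton {g : SL3} {l m n : ℝ} (h : HasEigenvalues g l m n)
    (v : Fin 3 → ℝ) :
    g • g • g • v - (l + m + n) • g • g • v + (l * m + l * n + m * n) • g • v
      - (l * m * n) • v = 0 := by
  have h1 := Matrix.aeval_self_charpoly g.1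
  rw [h.charpoly_eq] at h1
  have h2 := congrArg (fun M => Matrix.mulVec M v) h1
  simp only [map_sub, map_add, map_mul, Polynomial.aeval_X, Polynomial.aeval_C,
    Matrix.sub_mulVec, Matrix.add_mulVec, Matrix.zero_mulVec, Algebra.algebraMap_eq_smul_one,
    smul_mul_assoc, one_mul, Matrix.smul_mulVec, Matrix.one_mulVec, pow_succ, pow_zero,
    ← Matrix.mulVec_mulVec, add_mul] at h2
  rw [← h2]
  simp only [← smul_smul, add_smul, Matrix.SpecialLinearGroup.smul_def, Matrix.smul_eq_mulVec]

/-- A projective transformation with positive eigenvalues that preserves a convex domain preserves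
each of the two half-cones over it. -/
theorem IsConeOver.smul_mem_of_hasEigenvalues {C : Set (Fin 3 → ℝ)} {f : (Fin 3 → ℝ) →ₗ[ℝ] ℝ}
    {Ω : Set RP2} (hC : IsConeOver C f Ω) {g : SL3} {l m n : ℝ} (hg : HasEigenvalues g l m n)
    (hΩ : ∀ q ∈ Ω, g • q ∈ Ω) : ∀ v ∈ C, g • v ∈ C := by
  have hcases : (∀ v ∈ (fun v => g • v) '' C, v ∈ C) ∨ (∀ v ∈ (fun v => g • v) '' C, -v ∈ C) := by
    refine hC.subset_or_neg_subset (hC.convex.linear_image (Matrix.toLin' g.1)) ?_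
    rintro _ ⟨v, hv, rfl⟩
    obtain ⟨q, hq, hvq⟩ := hC.exists_mem v hv
    exact hC.mem_or _ (hΩ q hq) _ (hvq.mapsTo g)
  rcases hcases with h | h
  · exact fun v hv => h _ ⟨v, hv, rfl⟩
  intro v hv
  exfalso
  -- If `g` swaps the half-cones, then v, −gv, g²v, −g³v all lie in `C`. The characteristic
  -- polynomial has alternating signs, so `f` makes all four terms of Cayley–Hamilton negative, yet
  -- their sum is zero.
  have h1 : -(g • v) ∈ C := h _ ⟨v, hv, rfl⟩
  have h2 : -(g • -(g • v)) ∈ C := h _ ⟨_, h1, rfl⟩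
  have h3 : -(g • -(g • -(g • v))) ∈ C := h _ ⟨_, h2, rfl⟩
  simp only [smul_neg, neg_neg] at h2 h3
  have hl : 0 < l := hg.1
  have hm : 0 < m := hl.trans hg.2.1
  have hn : 0 < n := hm.trans hg.2.2.1
  have key := congrArg f (hg.cayley_hamilton v)
  simp only [map_add, map_sub, map_smul, smul_eq_mul, map_zero] at key
  have p0 := hC.pos _ hv
  have p1 := hC.pos _ h1
  have p2 := hC.pos _ h2
  have p3 := hC.pos _ h3
  rw [map_neg] at p1 p3
  have q2 : 0 < (l + m + n) * f (g • g • v) := by positivity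
  have q1 : 0 < (l * m + l * n + m * n) * -f (g • v) := by positivity
  have q0 : 0 < (l * m * n) * f v := by positivity
  linarith

/-! ### The ideal triangulation -/

namespace Pants

/-- Each line runs into both punctures with a different index, so limits along it towards such a
puncture are meaningful. -/
theorem neBot_comap_puncture {i k : Fin 3} (hik : k ≠ i) :
    (comap (Subtype.val : B i → Pants) (puncture k)).NeBot := by
  have key (F : Filter ℂ) (l : Filter ℝ) [l.NeBot] (hl : Tendsto (fun t : ℝ => (t : ℂ)) l F)
      (hB : ∀ᶠ t : ℝ in l, ∃ z ∈ B i, z.1 = (t : ℂ)) :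
      (comap (Subtype.val : B i → Pants) (comap Subtype.val F)).NeBot := by
    rw [comap_comap, comap_neBot_iff_frequently]
    refine hl.frequently (hB.mono ?_).frequently
    rintro t ⟨z, hz, hzt⟩
    exact ⟨⟨z, hz⟩, hzt⟩
  have hof (a : ℝ) (s : Set ℝ) : Tendsto (fun t : ℝ => (t : ℂ)) (𝓝[s] a) (𝓝 (a : ℂ)) :=
    (Complex.continuous_ofReal.tendsto a).mono_left nhdsWithin_le_nhds
  have htop : Tendsto (fun t : ℝ => (t : ℂ)) atTop (Bornology.cobounded ℂ) := by
    rw [← tendsto_norm_atTop_iff_cobounded]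
    simpa using tendsto_abs_atTop_atTop
  have hbot : Tendsto (fun t : ℝ => (t : ℂ)) atBot (Bornology.cobounded ℂ) := by
    rw [← tendsto_norm_atTop_iff_cobounded]
    simpa using tendsto_abs_atBot_atTop
  have mk (t : ℝ) (h0 : t ≠ 0) (h1 : t ≠ 1) : (t : ℂ) ≠ 0 ∧ (t : ℂ) ≠ 1 :=
    ⟨by exact_mod_cast h0, by exact_mod_cast h1⟩
  have b0 (t : ℝ) (h : t < 0) : ∃ z ∈ B 0, z.1 = (t : ℂ) :=
    ⟨⟨t, mk t h.ne (by linarith)⟩, ⟨Complex.ofReal_im t, h⟩, rfl⟩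
  have b1 (t : ℝ) (h : 1 < t) : ∃ z ∈ B 1, z.1 = (t : ℂ) :=
    ⟨⟨t, mk t (by linarith) h.ne'⟩, ⟨Complex.ofReal_im t, h⟩, rfl⟩
  have b2 (t : ℝ) (h : 0 < t) (h' : t < 1) : ∃ z ∈ B 2, z.1 = (t : ℂ) :=
    ⟨⟨t, mk t h.ne' h'.ne⟩, ⟨Complex.ofReal_im t, h, h'⟩, rfl⟩
  fin_cases i <;> fin_cases k <;> simp only [ne_eq, not_true_eq_false] at hik
  · exact key (𝓝 0) (𝓝[<] 0) (by simpa using hof 0 _)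
      (by filter_upwards [self_mem_nhdsWithin] with t ht using b0 t ht)
  · exact key _ atBot hbot
      (by filter_upwards [eventually_lt_atBot 0] with t ht using b0 t ht)
  · exact key (𝓝 1) (𝓝[>] 1) (by simpa using hof 1 _)
      (by filter_upwards [self_mem_nhdsWithin] with t ht using b1 t ht)
  · exact key _ atTop htop
      (by filter_upwards [eventually_gt_atTop 1] with t ht using b1 t ht)
  · exact key (𝓝 1) (𝓝[<] 1) (by simpa using hof 1 _)
      (by filter_upwards [Ioo_mem_nhdsLT (zero_lt_one' ℝ)] with t ht using b2 t ht.1 ht.2)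
  · exact key (𝓝 0) (𝓝[>] 0) (by simpa using hof 0 _)
      (by filter_upwards [Ioo_mem_nhdsGT (zero_lt_one' ℝ)] with t ht using b2 t ht.1 ht.2)

theorem B_nonempty (i : Fin 3) : (B i).Nonempty := by
  have := neBot_comap_puncture (i := i) (k := i + 1) (by simp)
  obtain ⟨z⟩ := (comap (Subtype.val : B i → Pants) (puncture (i + 1))).nonempty_of_neBot
  exact ⟨z.1, z.2⟩

theorem exists_mem_B {z : Pants} (h : z ∈ Tplus) (h' : z ∈ Tminus) : ∃ i, z ∈ B i := by
  have hz : z.1.im = 0 := le_antisymm h' h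
  have h0 : z.1.re ≠ 0 := fun h => z.2.1 (Complex.ext h hz)
  have h1 : z.1.re ≠ 1 := fun h => z.2.2 (Complex.ext h hz)
  rcases lt_or_gt_of_ne h0 with h | h
  · exact ⟨0, hz, h⟩
  rcases lt_or_gt_of_ne h1 with h' | h'
  · exact ⟨2, hz, h, h'⟩
  · exact ⟨1, hz, h'⟩

end Pants

theorem IsStraightOn.tendsto_vertex {T : Set Pants} {h : T → RP2} {Δ : ProjTriangle}
    (hs : IsStraightOn T h Δ) {i : Fin 3} (hi : Pants.B i ⊆ T) (j : Fin 3) :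
    Tendsto (fun z : Pants.B i => h ⟨z, hi z.2⟩)
      (comap (Subtype.val : Pants.B i → Pants) (Pants.puncture j)) (𝓝 (Δ.vertex j)) :=
  (hs.2.2 j).comp (tendsto_comap_iff.2 tendsto_comap)

/-- A vertex is the limit of the map along an adjacent line, so two maps that agree on the line
share the vertices at its two ends. -/
theorem IsStraightOn.vertex_eq {T T' : Set Pants} {h : T → RP2} {h' : T' → RP2}
    {Δ Δ' : ProjTriangle} (hs : IsStraightOn T h Δ) (hs' : IsStraightOn T' h' Δ') {i : Fin 3}
    (hi : Pants.B i ⊆ T) (hi' : Pants.B i ⊆ T')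
    (heq : ∀ z (hz : z ∈ Pants.B i), h ⟨z, hi hz⟩ = h' ⟨z, hi' hz⟩) {j : Fin 3} (hj : j ≠ i) :
    Δ.vertex j = Δ'.vertex j := by
  have := Pants.neBot_comap_puncture hj
  refine tendsto_nhds_unique (hs.tendsto_vertex hi j) ?_
  simpa only [heq _ (Subtype.prop _)] using hs'.tendsto_vertex hi' j

theorem IsStraightOn.smul_vertex {T : Set Pants} {h h' : T → RP2}
    {Δ Δ' : ProjTriangle} (hs : IsStraightOn T h Δ) (hs' : IsStraightOn T h' Δ') {i : Fin 3}
    (hi : Pants.B i ⊆ T) {g : SL3} (heq : ∀ z, g • h z = h' z) {j : Fin 3} (hj : j ≠ i) :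
    g • Δ.vertex j = Δ'.vertex j := by
  have := Pants.neBot_comap_puncture hj
  refine tendsto_nhds_unique
    (((RP2.continuous_smul g).tendsto _).comp (hs.tendsto_vertex hi j)) ?_
  simpa only [← heq, Function.comp_def] using hs'.tendsto_vertex hi j

theorem IsStraightOn.mem_side {T : Set Pants} {h : T → RP2} {Δ : ProjTriangle}
    (hs : IsStraightOn T h Δ) {i : Fin 3} (z : T) (hz : z.1 ∈ Pants.B i) : h z ∈ Δ.side i := by
  rw [← hs.2.1 i]
  exact ⟨z, hz, rfl⟩

/-! ### Triangles in a convex domain -/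

theorem sum_fin_three_eq {M : Type*} [AddCommMonoid M] (i : Fin 3) (f : Fin 3 → M) :
    ∑ j, f j = f (i + 1) + f i + f (i - 1) := by
  rw [Fin.sum_univ_three]
  fin_cases i
  · change _ = f 1 + f 0 + f 2
    abel
  · change _ = f 2 + f 1 + f 0
    abel
  · change _ = f 0 + f 2 + f 1
    abel

namespace ProjTriangle

/-- The triangle, with its homogeneous coordinates, lies in the closed half-cone `C`. -/
def IsPositive (Δ : ProjTriangle) (C : Set (Fin 3 → ℝ)) : Prop :=
  ∀ c : Fin 3 → ℝ, (∀ i, 0 ≤ c i) → (∃ i j, i ≠ j ∧ 0 < c i ∧ 0 < c j) →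
    ∑ i, c i • Δ.vert i ∈ C

/-- The same triangle, with opposite homogeneous coordinates. -/
def neg (Δ : ProjTriangle) : ProjTriangle where
  vert := fun i => -Δ.vert i
  indep := Δ.indep.map' (LinearEquiv.neg ℝ).toLinearMap (LinearEquiv.ker _)

/-- The image of a triangle under a projective transformation. -/
def map (Δ : ProjTriangle) (g : SL3) : ProjTriangle where
  vert := fun i => g • Δ.vert i
  indep := Δ.indep.map' (Matrix.toLin' g.1) (LinearMap.ker_eq_bot.2 (MulAction.injective g))

variable {C : Set (Fin 3 → ℝ)} {f : (Fin 3 → ℝ) →ₗ[ℝ] ℝ} {Ω : Set RP2}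

theorem IsPositive.add_mem {Δ : ProjTriangle} (h : Δ.IsPositive C) {i j : Fin 3} (hij : i ≠ j)
    {α β : ℝ} (hα : 0 < α) (hβ : 0 < β) : α • Δ.vert i + β • Δ.vert j ∈ C := by
  have hs (i : Fin 3) {a : ℝ} (ha : 0 ≤ a) (k : Fin 3) : 0 ≤ (Pi.single i a : Fin 3 → ℝ) k := by
    rw [Pi.single_apply]
    split_ifs
    exacts [ha, le_rfl]
  have := h (Pi.single i α + Pi.single j β)
    (fun k => add_nonneg (hs i hα.le k) (hs j hβ.le k))
    ⟨i, j, hij, by simpa [hij] using hα, by simpa [hij.symm] using hβ⟩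
  simpa [add_smul, Finset.sum_add_distrib, Pi.single_apply, ite_smul] using this

theorem IsPositive.map {Δ : ProjTriangle} (h : Δ.IsPositive C) {g : SL3}
    (hg : ∀ v ∈ C, g • v ∈ C) : (Δ.map g).IsPositive C := by
  intro c hc hc'
  have := hg _ (h c hc hc')
  simpa only [Finset.smul_sum, smul_comm g, ProjTriangle.map] using this

/-- The combinations with non-negative coefficients, at least two of them positive, form a convex
set of representatives of points of the domain; such a set cannot meet both half-cones. -/
theorem exists_isPositive (hC : IsConeOver C f Ω) (Δ : ProjTriangle) (h : Δ.minusVertices ⊆ Ω) :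
    Δ.IsPositive C ∨ Δ.neg.IsPositive C := by
  let S : Set (Fin 3 → ℝ) := {v | ∃ c : Fin 3 → ℝ, ((∀ i, 0 ≤ c i) ∧
    ∃ i j, i ≠ j ∧ 0 < c i ∧ 0 < c j) ∧ v = ∑ i, c i • Δ.vert i}
  have hS : Convex ℝ S := by
    rintro _ ⟨c, ⟨hc, i, j, hij, hi, hj⟩, rfl⟩ _ ⟨d, ⟨hd, i', j', hij', hi', hj'⟩, rfl⟩ a b ha hb hab
    refine ⟨a • c + b • d, ⟨fun k => ?_, ?_⟩, ?_⟩
    · exact add_nonneg (mul_nonneg ha (hc k)) (mul_nonneg hb (hd k))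
    · rcases ha.eq_or_lt with rfl | ha
      · obtain rfl : b = 1 := by linarith
        exact ⟨i', j', hij', by simpa using hi', by simpa using hj'⟩
      · exact ⟨i, j, hij, add_pos_of_pos_of_nonneg (mul_pos ha hi) (mul_nonneg hb (hd i)),
          add_pos_of_pos_of_nonneg (mul_pos ha hj) (mul_nonneg hb (hd j))⟩
    · simp [Finset.smul_sum, ← Finset.sum_add_distrib, add_smul, smul_smul]
  have hne : ∀ v ∈ S, v ≠ 0 := by
    rintro _ ⟨c, ⟨-, i, j, -, hi, -⟩, rfl⟩ h0
    exact hi.ne' (Fintype.linearIndependent_iff.1 Δ.indep c h0 i)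
  have hmem : ∀ v ∈ S, v ∈ C ∨ -v ∈ C := by
    intro v hv
    have hv0 := hne v hv
    obtain ⟨c, ⟨hc, hc'⟩, rfl⟩ := hv
    exact hC.mem_or _ (h ⟨c, hc, hc', hv0, rfl⟩) _ ⟨hv0, rfl⟩
  rcases hC.subset_or_neg_subset hS hmem with h | h
  · exact Or.inl fun c hc hc' => h _ ⟨c, ⟨hc, hc'⟩, rfl⟩
  · refine Or.inr fun c hc hc' => ?_
    simpa [neg] using h _ ⟨c, ⟨hc, hc'⟩, rfl⟩

end ProjTriangle

/-! ### Index arithmetic modulo 3 -/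

namespace FinThree

theorem add_one_add_one (i : Fin 3) : i + 1 + 1 = i - 1 := by decide +revert

theorem sub_one_sub_one (i : Fin 3) : i - 1 - 1 = i + 1 := by decide +revert

theorem sub_one_ne_add_one (i : Fin 3) : i - 1 ≠ i + 1 := by decide +revert

theorem eq_or (i j : Fin 3) : j = i ∨ j = i + 1 ∨ j = i - 1 := by decide +revert

theorem eq_sub_one_or_eq_add_one {i j : Fin 3} (h : j ≠ i) : j = i - 1 ∨ j = i + 1 := by
  decide +revert

end FinThree

namespace ProjTriangle

variable {C : Set (Fin 3 → ℝ)} {f : (Fin 3 → ℝ) →ₗ[ℝ] ℝ} {Ω : Set RP2}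

theorem neg_vertex (Δ : ProjTriangle) (i : Fin 3) : Δ.neg.vertex i = Δ.vertex i :=
  (Projectivization.mk_eq_mk_iff' ℝ _ _ _ _).2 ⟨-1, by simp [neg]⟩

theorem isHomCoord_neg {v : Fin 3 → ℝ} {q : RP2} : IsHomCoord (-v) q ↔ IsHomCoord v q := by
  constructor <;> intro h
  · simpa using h.rescale (r := -1) (by norm_num)
  · simpa using h.rescale (r := -1) (by norm_num)

theorem neg_minusVertices (Δ : ProjTriangle) : Δ.neg.minusVertices = Δ.minusVertices := by
  simp only [minusVertices, neg, smul_neg, Finset.sum_neg_distrib, isHomCoord_neg]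

theorem neg_side (Δ : ProjTriangle) (i : Fin 3) : Δ.neg.side i = Δ.side i := by
  simp only [side, neg, smul_neg, ← neg_add, isHomCoord_neg]

theorem smul_mem_side_map {Δ : ProjTriangle} {i : Fin 3} {q : RP2} (h : q ∈ Δ.side i) (g : SL3) :
    g • q ∈ (Δ.map g).side i := by
  obtain ⟨α, β, hα, hβ, h⟩ := h
  refine ⟨α, β, hα, hβ, ?_⟩
  simpa only [smul_add, smul_comm g, map] using h.mapsTo g

/-- Two positive triangles that share two vertices and a point of the open side between them have
positively proportional homogeneous coordinates at the shared vertices. -/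
theorem IsPositive.exists_pos_smul (hC : IsConeOver C f Ω) {Δ Δ' : ProjTriangle}
    (h : Δ.IsPositive C) (h' : Δ'.IsPositive C) {i : Fin 3}
    (hv : ∀ j, j ≠ i → Δ.vertex j = Δ'.vertex j) {q : RP2} (hq : q ∈ Δ.side i)
    (hq' : q ∈ Δ'.side i) {j : Fin 3} (hj : j ≠ i) :
    ∃ k : ℝ, 0 < k ∧ Δ'.vert j = k • Δ.vert j := by
  have hne := FinThree.sub_one_ne_add_one i
  obtain ⟨k₁, -, hk₁⟩ := (Δ'.isHomCoord_vertex (i - 1)).exists_smul_eq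
    (v := Δ.vert (i - 1)) (hv (i - 1) (by simp) ▸ Δ.isHomCoord_vertex _)
  obtain ⟨k₂, -, hk₂⟩ := (Δ'.isHomCoord_vertex (i + 1)).exists_smul_eq
    (v := Δ.vert (i + 1)) (hv (i + 1) (by simp) ▸ Δ.isHomCoord_vertex _)
  obtain ⟨α, β, hα, hβ, hu⟩ := hq
  obtain ⟨α', β', hα', hβ', hu'⟩ := hq'
  obtain ⟨r, -, hr⟩ := hu.exists_smul_eq hu'
  have p := hC.pos _ (h.add_mem hne hα hβ)
  have p' := hC.pos _ (h'.add_mem hne hα' hβ')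
  rw [hr, map_smul, smul_eq_mul] at p
  -- Both representatives of the common point lie in `C`, where `f` is positive. Comparing
  -- coefficients along the side then transfers the sign to both factors.
  have hrpos : 0 < r := (pos_iff_pos_of_mul_pos p).2 p'
  have hli : LinearIndependent ℝ ![Δ.vert (i - 1), Δ.vert (i + 1)] := by
    have := Δ.indep.comp ![i - 1, i + 1] (by
      intro a b
      fin_cases a <;> fin_cases b <;> simp [hne, hne.symm])
    convert this using 1
    ext a
    fin_cases a <;> rfl
  have hzero : (α - r * α' * k₁) • Δ.vert (i - 1) + (β - r * β' * k₂) • Δ.vert (i + 1) = 0 := by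
    rw [hk₁, hk₂] at hr
    rw [sub_smul, sub_smul, sub_add_sub_comm, hr]
    simp only [smul_add, smul_smul, mul_assoc, sub_self]
  obtain ⟨h1, h2⟩ := LinearIndependent.pair_iff.1 hli _ _ hzero
  have hk₁pos : 0 < k₁ := pos_of_mul_pos_right (a := r * α') (by linarith) (by positivity)
  have hk₂pos : 0 < k₂ := pos_of_mul_pos_right (a := r * β') (by linarith) (by positivity)
  have hj' := FinThree.eq_sub_one_or_eq_add_one hj
  rcases hj' with rfl | rfl
  exacts [⟨k₁, hk₁pos, hk₁⟩, ⟨k₂, hk₂pos, hk₂⟩]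

theorem exists_coord (Δ : ProjTriangle) (v : Fin 3 → ℝ) :
    ∃ c : Fin 3 → ℝ, v = ∑ i, c i • Δ.vert i := by
  let b := basisOfLinearIndependentOfCardEqFinrank Δ.indep (by simp)
  refine ⟨b.repr v, ?_⟩
  conv_lhs => rw [← b.sum_repr v]
  simp [b]

end ProjTriangle

/-- Changing the sign of all three homogeneous coordinate vectors alters neither the triangle nor
its sides and vertices. -/
theorem IsStraightOn.exists_isPositive {C : Set (Fin 3 → ℝ)} {f : (Fin 3 → ℝ) →ₗ[ℝ] ℝ}
    {Ω : Set RP2} (hC : IsConeOver C f Ω) {T : Set Pants} {h : T → RP2} {Δ : ProjTriangle}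
    (hs : IsStraightOn T h Δ) (hΩ : ∀ z, h z ∈ Ω) :
    ∃ Δ' : ProjTriangle, Δ'.IsPositive C ∧ (∀ i, Δ'.vertex i = Δ.vertex i) ∧
      IsStraightOn T h Δ' := by
  have hsub : Δ.minusVertices ⊆ Ω := by
    rw [← hs.1]
    rintro _ ⟨z, rfl⟩
    exact hΩ z
  rcases ProjTriangle.exists_isPositive hC Δ hsub with h1 | h1
  · exact ⟨Δ, h1, fun _ => rfl, hs⟩
  · refine ⟨Δ.neg, h1, Δ.neg_vertex, ?_⟩
    simpa only [IsStraightOn, ProjTriangle.neg_vertex, ProjTriangle.neg_side,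
      ProjTriangle.neg_minusVertices] using hs

/-! ### Deck transformations -/

theorem Deck.eq_one_of_apply_eq {X M : Type*} [TopologicalSpace X] [TopologicalSpace M]
    [PreconnectedSpace X] {p : X → M} (hp : IsCoveringMap p) {γ : Deck p} {x : X}
    (h : γ.1 x = x) : γ = 1 := by
  have h1 := hp.eq_of_comp_eq γ.1.continuous continuous_id (funext γ.2) x h
  exact Subtype.ext (Homeomorph.ext (congrFun h1))

/-- The three factors permute the lifts of T₋ cyclically, T̃_i → T̃_{i+1} → T̃_{i−1} → T̃_i, so the
product has a fixed point. -/
theorem TriangleLifts.AreBoundaryElements.mul_mul_eq_one {X : Type*} [TopologicalSpace X]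
    [PreconnectedSpace X] {p : X → Pants} (hp : IsCoveringMap p) {L : TriangleLifts p}
    {A : Fin 3 → Deck p} (hA : L.AreBoundaryElements A) (i : Fin 3) :
    A (i + 1) * A i * A (i - 1) = 1 := by
  obtain ⟨z, hz⟩ := Pants.B_nonempty 0
  let w : Pants.Tminus := ⟨z, Pants.B_subset_Tminus 0 hz⟩
  refine Deck.eq_one_of_apply_eq hp (x := L.minus i w) ?_
  change (A (i + 1)).1 ((A i).1 ((A (i - 1)).1 (L.minus i w))) = L.minus i w
  have h1 := hA (i - 1) w
  have h2 := hA i w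
  have h3 := hA (i + 1) w
  rw [sub_add_cancel, FinThree.sub_one_sub_one] at h1
  rw [FinThree.add_one_add_one, add_sub_cancel_right] at h3
  rw [h1, h2, h3]

/-! ### The configuration of the four triangles -/

/-- The vertices `E i` of the central triangle, the third vertices `Q i` of the three adjacent
triangles, and the action of the boundary monodromies `M i` on them. -/
structure PantsFrame (M : Fin 3 → SL3) (lam : Fin 3 → ℝ) where
  E : Fin 3 → Fin 3 → ℝ
  Q : Fin 3 → Fin 3 → ℝ
  indep : LinearIndependent ℝ E
  a : Fin 3 → ℝ
  b : Fin 3 → ℝ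
  β : Fin 3 → ℝ
  γ : Fin 3 → ℝ
  a_pos : ∀ i, 0 < a i
  b_pos : ∀ i, 0 < b i
  β_pos : ∀ i, 0 < β i
  γ_pos : ∀ i, 0 < γ i
  Q_eq : ∀ i, Q i = a i • E (i + 1) - E i + b i • E (i - 1)
  smul_E : ∀ i, M i • E i = lam i • E i
  smul_E_sub : ∀ i, M i • E (i - 1) = β i • Q (i - 1)
  smul_Q_add : ∀ i, M i • Q (i + 1) = γ i • E (i + 1)

/-- The signs of the coordinates of the third vertex of an adjacent triangle: the triangles lie on
different sides of the common side, and no vertex belongs to the domain. -/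
theorem coord_signs {C : Set (Fin 3 → ℝ)} {f : (Fin 3 → ℝ) →ₗ[ℝ] ℝ} {Ω : Set RP2}
    (hC : IsConeOver C f Ω) {Δ Δ' : ProjTriangle} (h : Δ.IsPositive C) (h' : Δ'.IsPositive C)
    {i : Fin 3} (hk : ∀ j, j ≠ i → ∃ k : ℝ, 0 < k ∧ Δ'.vert j = k • Δ.vert j)
    (hdisj : ∀ q ∈ Δ.minusVertices, q ∈ Δ'.minusVertices → ∃ j, q ∈ Δ.side j)
    (hv : ∀ j, Δ.vertex j ∉ Ω) {c : Fin 3 → ℝ} (hc : Δ'.vert i = ∑ j, c j • Δ.vert j) :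
    c i < 0 ∧ ∀ j, j ≠ i → 0 < c j := by
  have hadj (j : Fin 3) (hj : j ≠ i) {r : ℝ} (hr : 0 < r) :
      Δ'.vert i + r • Δ.vert j ∈ C := by
    obtain ⟨k, hk, hkj⟩ := hk j hj
    have := h'.add_mem hj.symm one_pos (div_pos hr hk)
    rwa [hkj, smul_smul, div_mul_cancel₀ _ hk.ne', one_smul] at this
  have hci : c i < 0 := by
    by_contra! hci
    have hci' : 0 < c i := by
      refine lt_of_le_of_ne hci fun h0 => ?_
      obtain ⟨k₁, hk₁, h1⟩ := hk (i + 1) (by simp)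
      obtain ⟨k₂, hk₂, h2⟩ := hk (i - 1) (by simp)
      rw [sum_fin_three_eq i, ← h0, zero_smul, add_zero] at hc
      -- A vanishing coefficient would put the third vertex on the line through the two shared ones.
      have hz : ∑ j, (fun j => if j = i then (1 : ℝ) else if j = i + 1 then -(c (i + 1) / k₁)
          else -(c (i - 1) / k₂)) j • Δ'.vert j = 0 := by
        rw [sum_fin_three_eq i]
        have e1 : i + 1 ≠ i := by simp
        have e2 : i - 1 ≠ i := by simp
        have e3 := FinThree.sub_one_ne_add_one i
        simp only [e1, e2, e3, if_true, if_false]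
        rw [hc, h1, h2, smul_smul, smul_smul, neg_mul, neg_mul, div_mul_cancel₀ _ hk₁.ne',
          div_mul_cancel₀ _ hk₂.ne']
        module
      have := Fintype.linearIndependent_iff.1 Δ'.indep _ hz i
      simp at this
    obtain ⟨k₁, hk₁, h1⟩ := hk (i + 1) (by simp)
    obtain ⟨k₂, hk₂, h2⟩ := hk (i - 1) (by simp)
    -- Adding large multiples of the shared vertices to the third vertex makes all its coordinates
    -- in Δ positive: the two triangles would then have a common interior point, which lies on no
    -- side of Δ.
    obtain ⟨m₁, hm₁, hm₁'⟩ : ∃ m : ℝ, 0 < m ∧ 0 < m + c (i + 1) :=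
      ⟨|c (i + 1)| + 1, by positivity, by linarith [neg_abs_le (c (i + 1))]⟩
    obtain ⟨m₂, hm₂, hm₂'⟩ : ∃ m : ℝ, 0 < m ∧ 0 < m + c (i - 1) :=
      ⟨|c (i - 1)| + 1, by positivity, by linarith [neg_abs_le (c (i - 1))]⟩
    have e1 : i + 1 ≠ i := by simp
    have e2 : i - 1 ≠ i := by simp
    have e3 := FinThree.sub_one_ne_add_one i
    have hcases := FinThree.eq_or i
    let d : Fin 3 → ℝ := fun j => if j = i then c i else if j = i + 1 then m₁ + c (i + 1)
      else m₂ + c (i - 1)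
    let d' : Fin 3 → ℝ := fun j => if j = i then 1 else if j = i + 1 then m₁ / k₁ else m₂ / k₂
    have hd (j : Fin 3) : 0 < d j := by
      rcases hcases j with rfl | rfl | rfl <;> simp [d, *]
    have hd' (j : Fin 3) : 0 < d' j := by
      rcases hcases j with rfl | rfl | rfl <;> simp [d', *]
    have heq : ∑ j, d j • Δ.vert j = ∑ j, d' j • Δ'.vert j := by
      rw [sum_fin_three_eq i] at hc ⊢
      rw [sum_fin_three_eq i]
      simp only [d, d', e1, e2, e3, if_true, if_false]
      rw [hc, h1, h2, smul_smul, smul_smul, div_mul_cancel₀ _ hk₁.ne', div_mul_cancel₀ _ hk₂.ne']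
      module
    have hne : ∑ j, d j • Δ.vert j ≠ 0 := fun h0 =>
      (hd i).ne' (Fintype.linearIndependent_iff.1 Δ.indep d h0 i)
    obtain ⟨j, α, β, -, -, hq⟩ := hdisj (Projectivization.mk ℝ _ hne)
      ⟨d, fun j => (hd j).le, ⟨0, 1, by simp, hd _, hd _⟩, hne, rfl⟩
      ⟨d', fun j => (hd' j).le, ⟨0, 1, by simp, hd' _, hd' _⟩, heq ▸ hne, by simp only [heq]⟩
    obtain ⟨r, -, hr⟩ := IsHomCoord.exists_smul_eq ⟨hne, rfl⟩ hq
    have hz : ∑ l, (d - fun l => if l = j then 0 else if l = j + 1 then r * β else r * α) l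
        • Δ.vert l = 0 := by
      simp only [Pi.sub_apply, sub_smul, Finset.sum_sub_distrib]
      rw [hr, sum_fin_three_eq j]
      have e1 : j + 1 ≠ j := by simp
      have e2 : j - 1 ≠ j := by simp
      have e3 := FinThree.sub_one_ne_add_one j
      simp only [e1, e2, e3, if_true, if_false]
      module
    have := Fintype.linearIndependent_iff.1 Δ.indep _ hz j
    simp only [Pi.sub_apply, if_true, sub_zero] at this
    exact (hd j).ne' this
  refine ⟨hci, fun j hj => ?_⟩
  by_contra! hcj
  obtain ⟨k, hki, hkj, hsum⟩ : ∃ k, k ≠ i ∧ k ≠ j ∧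
      ∑ l, c l • Δ.vert l = c i • Δ.vert i + c j • Δ.vert j + c k • Δ.vert k := by
    have hj' := FinThree.eq_sub_one_or_eq_add_one hj
    have e3 := FinThree.sub_one_ne_add_one i
    rcases hj' with rfl | rfl
    · exact ⟨i + 1, by simp, e3.symm, by rw [sum_fin_three_eq i]; module⟩
    · exact ⟨i - 1, by simp, e3, by rw [sum_fin_three_eq i]; module⟩
  rw [hsum] at hc
  -- This vector is chosen to cancel the `i` and `j` components of Δ'ᵢ. If `c j ≤ 0` it lies in `C`,
  -- and the sum is a positive multiple of vertex `k`, which would put that vertex in the domain.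
  have hmem : (-c i) • Δ.vert i + (|c k| + 1) • Δ.vert k + (-c j) • Δ.vert j ∈ C := by
    rcases hcj.eq_or_lt with h0 | hcj
    · rw [h0, neg_zero, zero_smul, add_zero]
      exact h.add_mem hki.symm (neg_pos.2 hci) (by positivity)
    · have h1 := hC.add_mem _
        (h.add_mem hki.symm (neg_pos.2 hci) (half_pos (show 0 < |c k| + 1 by positivity))) _
        (h.add_mem hkj (half_pos (show 0 < |c k| + 1 by positivity)) (neg_pos.2 hcj))
      convert h1 using 1
      module
  have h2 := hC.add_mem _ (hadj k hki one_pos) _ hmem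
  have h3 : Δ'.vert i + (1 : ℝ) • Δ.vert k +
      ((-c i) • Δ.vert i + (|c k| + 1) • Δ.vert k + (-c j) • Δ.vert j) =
      (c k + |c k| + 2) • Δ.vert k := by
    rw [hc]
    module
  rw [h3] at h2
  refine hv k (hC.mem_of_isHomCoord h2 ((Δ.isHomCoord_vertex k).rescale ?_))
  linarith [neg_abs_le (c k)]

/-- This is the passage from geometry to linear algebra: all later arguments about the triangles use
only the resulting vectors and scale factors. -/
theorem GoldmanPosition.exists_pantsFrame {X : Type*} [TopologicalSpace X] [PreconnectedSpace X]
    {p : X → Pants} (hp : IsCoveringMap p) {π : ProjectiveStructure Pants} {D : Development π p}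
    (hD : D.IsConvex) {L : TriangleLifts p} {A : Fin 3 → Deck p} (hA : L.AreBoundaryElements A)
    {lam mu nu : Fin 3 → ℝ} (hev : ∀ i, HasEigenvalues (D.ρ (A i)) (lam i) (mu i) (nu i))
    (G : GoldmanPosition D L A lam) :
    ∃ P : PantsFrame (fun i => D.ρ (A i)) lam,
      (∀ i, IsHomCoord (P.E i) (G.Δplus.vertex i)) ∧
      ∀ i, IsHomCoord (P.Q i) ((G.Δ i).vertex i) := by
  obtain ⟨C, f, hC⟩ := hD.2.exists_isConeOver
  have hMC (i : Fin 3) : ∀ v ∈ C, D.ρ (A i) • v ∈ C := by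
    refine hC.smul_mem_of_hasEigenvalues (hev i) ?_
    rintro _ ⟨x, rfl⟩
    exact ⟨(A i).1 x, D.equivariant (A i) x⟩
  obtain ⟨Δ, hΔ, hΔv, hΔs⟩ := G.straight_plus.exists_isPositive hC fun z => ⟨_, rfl⟩
  have hex (i : Fin 3) := (G.straight_minus i).exists_isPositive hC fun z => ⟨_, rfl⟩
  choose Δ' hΔ' hΔv' hΔs' using hex
  have hagree (i : Fin 3) (z : Pants) (hz : z ∈ Pants.B i) :
      D.dev (G.h (L.plus ⟨z, Pants.B_subset_Tplus i hz⟩)) =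
        D.dev (G.h (L.minus i ⟨z, Pants.B_subset_Tminus i hz⟩)) := by
    rw [L.adjacent i z hz]
  have hshared (i j : Fin 3) (hj : j ≠ i) : ∃ k : ℝ, 0 < k ∧ (Δ' i).vert j = k • Δ.vert j := by
    obtain ⟨z, hz⟩ := Pants.B_nonempty i
    refine hΔ.exists_pos_smul hC (hΔ' i)
      (fun l hl => hΔs.vertex_eq (hΔs' i) _ _ (hagree i) hl)
      (hΔs.mem_side ⟨z, Pants.B_subset_Tplus i hz⟩ hz) ?_ hj
    simp only [hagree i z hz]
    exact (hΔs' i).mem_side ⟨z, Pants.B_subset_Tminus i hz⟩ hz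
  have hmove (i : Fin 3) (z : Pants.Tminus) :
      D.ρ (A i) • D.dev (G.h (L.minus (i + 1) z)) = D.dev (G.h (L.minus (i - 1) z)) := by
    rw [← D.equivariant, ← G.commutes, hA i z]
  -- Any side through vertex `j` would serve for the comparison; the one opposite to `j + 1` is
  -- used.
  have hmap (i j : Fin 3) :
      ∃ k : ℝ, 0 < k ∧ (Δ' (i - 1)).vert j = k • D.ρ (A i) • (Δ' (i + 1)).vert j := by
    obtain ⟨z, hz⟩ := Pants.B_nonempty (j + 1)
    let w : Pants.Tminus := ⟨z, Pants.B_subset_Tminus _ hz⟩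
    refine ((hΔ' (i + 1)).map (hMC i)).exists_pos_smul hC (hΔ' (i - 1)) (i := j + 1)
      (fun l hl => ?_)
      (ProjTriangle.smul_mem_side_map ((hΔs' (i + 1)).mem_side w hz) _) ?_ (by simp)
    · exact (hΔs' (i + 1)).smul_vertex (hΔs' (i - 1)) (Pants.B_subset_Tminus _) (hmove i) hl
    · rw [hmove i w]
      exact (hΔs' (i - 1)).mem_side w hz
  -- The developing map is injective, so a common point comes from a common point of the lifts,
  -- which lies over T₊ ∩ T₋, the union of the lines.
  have hdisj (i : Fin 3) : ∀ q ∈ Δ.minusVertices, q ∈ (Δ' i).minusVertices →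
      ∃ j, q ∈ Δ.side j := by
    intro q hq hq'
    rw [← hΔs.1] at hq
    rw [← (hΔs' i).1] at hq'
    obtain ⟨z, rfl⟩ := hq
    obtain ⟨w, hw⟩ := hq'
    have h1 := congrArg p (G.h.injective (hD.1.injective hw))
    rw [L.p_plus, L.p_minus] at h1
    obtain ⟨j, hj⟩ := Pants.exists_mem_B z.2 (h1 ▸ w.2)
    exact ⟨j, hΔs.mem_side z hj⟩
  have hfix (i : Fin 3) : D.ρ (A i) • Δ.vert i = lam i • Δ.vert i := by
    obtain ⟨r, -, hr⟩ := (Δ.isHomCoord_vertex i).exists_smul_eq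
      (hΔv i ▸ G.Δplus.isHomCoord_vertex i)
    rw [hr, smul_comm, G.repelling i, smul_comm]
  -- A vertex in the domain would give a fixed point of the deck transformation Aᵢ, forcing it to be
  -- trivial, against its distinct eigenvalues.
  have hnot (i : Fin 3) : Δ.vertex i ∉ Set.range D.dev := by
    rintro ⟨x, hx⟩
    have h1 : D.dev ((A i).1 x) = D.dev x := by
      rw [D.equivariant, hx]
      refine ((Δ.isHomCoord_vertex i).mapsTo _).unique ?_
      rw [hfix i]
      exact (Δ.isHomCoord_vertex i).rescale (hev i).1.ne'
    refine (hev i).ne_one ?_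
    rw [Deck.eq_one_of_apply_eq hp (hD.1.injective h1), map_one]
  have hcoord (i : Fin 3) := Δ.exists_coord ((Δ' i).vert i)
  choose c hc using hcoord
  have hsign (i : Fin 3) := coord_signs hC hΔ (hΔ' i) (hshared i) (hdisj i) hnot (hc i)
  have hQ (i : Fin 3) : (Δ' i).vert i = (-c i i) • (-c i i)⁻¹ • (Δ' i).vert i := by
    rw [smul_smul, mul_inv_cancel₀ (neg_pos.2 (hsign i).1).ne', one_smul]
  -- E_{i−1} is also a vertex of the triangle i+1, which M_i carries to the triangle i−1; there the
  -- vertex with this index is the outer one. The argument for `hQ_add` is the mirror image.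
  have hE_sub (i : Fin 3) : ∃ b : ℝ, 0 < b ∧ D.ρ (A i) • Δ.vert (i - 1) =
      b • (-c (i - 1) (i - 1))⁻¹ • (Δ' (i - 1)).vert (i - 1) := by
    obtain ⟨k, hk, h1⟩ := hshared (i + 1) (i - 1) (FinThree.sub_one_ne_add_one i)
    obtain ⟨l, hl, h2⟩ := hmap i (i - 1)
    have hpos := neg_pos.2 (hsign (i - 1)).1
    refine ⟨(l * k)⁻¹ * (-c (i - 1) (i - 1)), by positivity, ?_⟩
    rw [mul_smul, ← hQ, h2, h1, smul_comm _ k, smul_smul l, smul_smul,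
      inv_mul_cancel₀ (by positivity), one_smul]
  have hQ_add (i : Fin 3) : ∃ b : ℝ, 0 < b ∧
      D.ρ (A i) • (-c (i + 1) (i + 1))⁻¹ • (Δ' (i + 1)).vert (i + 1) = b • Δ.vert (i + 1) := by
    obtain ⟨k, hk, h1⟩ := hshared (i - 1) (i + 1) (FinThree.sub_one_ne_add_one i).symm
    obtain ⟨l, hl, h2⟩ := hmap i (i + 1)
    have hpos := neg_pos.2 (hsign (i + 1)).1
    refine ⟨(-c (i + 1) (i + 1))⁻¹ * (l⁻¹ * k), by positivity, ?_⟩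
    rw [mul_smul, mul_smul, ← h1, h2, smul_smul l⁻¹, inv_mul_cancel₀ hl.ne', one_smul, smul_comm]
  choose β hβ hβ' using hE_sub
  choose γ hγ hγ' using hQ_add
  refine ⟨{ E := Δ.vert
            Q := fun i => (-c i i)⁻¹ • (Δ' i).vert i
            indep := Δ.indep
            a := fun i => (-c i i)⁻¹ * c i (i + 1)
            b := fun i => (-c i i)⁻¹ * c i (i - 1)
            β := β
            γ := γ
            a_pos := fun i => mul_pos (inv_pos.2 (neg_pos.2 (hsign i).1)) ((hsign i).2 _ (by simp))
            b_pos := fun i => mul_pos (inv_pos.2 (neg_pos.2 (hsign i).1)) ((hsign i).2 _ (by simp))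
            β_pos := hβ
            γ_pos := hγ
            Q_eq := fun i => ?_
            smul_E := hfix
            smul_E_sub := hβ'
            smul_Q_add := hγ' }, fun i => ?_, fun i => ?_⟩
  · have hne := (hsign i).1.ne
    rw [hc i, sum_fin_three_eq i, smul_add, smul_add, smul_smul, smul_smul, smul_smul,
      show (-c i i)⁻¹ * c i i = -1 by rw [inv_neg, neg_mul, inv_mul_cancel₀ hne]]
    module
  · rw [← hΔv i]
    exact Δ.isHomCoord_vertex i
  · rw [← hΔv' i i]
    exact ((Δ' i).isHomCoord_vertex i).rescale (inv_pos.2 (neg_pos.2 (hsign i).1)).ne'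

/-! ### Wedge products -/

theorem wedge_add (u v w w' : Fin 3 → ℝ) : wedge u v (w + w') = wedge u v w + wedge u v w' := by
  simp only [wedge, Matrix.det_fin_three, Matrix.of_apply, Matrix.cons_val, Pi.add_apply]
  ring

theorem wedge_sub (u v w w' : Fin 3 → ℝ) : wedge u v (w - w') = wedge u v w - wedge u v w' := by
  simp only [wedge, Matrix.det_fin_three, Matrix.of_apply, Matrix.cons_val, Pi.sub_apply]
  ring

theorem wedge_smul (u v w : Fin 3 → ℝ) (r : ℝ) : wedge u v (r • w) = r * wedge u v w := by
  simp only [wedge, Matrix.det_fin_three, Matrix.of_apply, Matrix.cons_val, Pi.smul_apply,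
    smul_eq_mul]
  ring

theorem wedge_smul_left (u v w : Fin 3 → ℝ) (r : ℝ) : wedge (r • u) v w = r * wedge u v w := by
  simp only [wedge, Matrix.det_fin_three, Matrix.of_apply, Matrix.cons_val, Pi.smul_apply,
    smul_eq_mul]
  ring

theorem wedge_smul_middle (u v w : Fin 3 → ℝ) (r : ℝ) : wedge u (r • v) w = r * wedge u v w := by
  simp only [wedge, Matrix.det_fin_three, Matrix.of_apply, Matrix.cons_val, Pi.smul_apply,
    smul_eq_mul]
  ring

theorem wedge_cycle (u v w : Fin 3 → ℝ) : wedge u v w = wedge v w u := by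
  simp only [wedge, Matrix.det_fin_three, Matrix.of_apply, Matrix.cons_val]
  ring

theorem wedge_self_left (u v : Fin 3 → ℝ) : wedge u v u = 0 := by
  simp only [wedge, Matrix.det_fin_three, Matrix.of_apply, Matrix.cons_val]
  ring

theorem wedge_self_right (u v : Fin 3 → ℝ) : wedge u v v = 0 := by
  simp only [wedge, Matrix.det_fin_three, Matrix.of_apply, Matrix.cons_val]
  ring

theorem wedge_swap (u v w : Fin 3 → ℝ) : wedge u v w = -wedge v u w := by
  simp only [wedge, Matrix.det_fin_three, Matrix.of_apply, Matrix.cons_val]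
  ring

theorem wedge_SL3_smul (g : SL3) (u v w : Fin 3 → ℝ) :
    wedge (g • u) (g • v) (g • w) = wedge u v w := by
  have h : Matrix.of ![g • u, g • v, g • w] = Matrix.of ![u, v, w] * g.1.transpose := by
    ext i j
    fin_cases i <;> simp [Matrix.mul_apply, Matrix.SpecialLinearGroup.smul_def, Matrix.mulVec,
      dotProduct, mul_comm]
  rw [wedge, h, Matrix.det_mul, Matrix.det_transpose, g.2, mul_one, wedge]

theorem wedge_ne_zero_of_linearIndependent {E : Fin 3 → Fin 3 → ℝ} (h : LinearIndependent ℝ E)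
    {i j k : Fin 3} (hij : i ≠ j) (hik : i ≠ k) (hjk : j ≠ k) : wedge (E i) (E j) (E k) ≠ 0 := by
  have h1 := h.comp ![i, j, k] (by
    intro a b
    fin_cases a <;> fin_cases b <;> simp [hij, hik, hjk, hij.symm, hik.symm, hjk.symm])
  have h2 : E ∘ ![i, j, k] = (Matrix.of ![E i, E j, E k]).row := by
    funext a
    fin_cases a <;> rfl
  rw [h2, Matrix.linearIndependent_rows_iff_isUnit, Matrix.isUnit_iff_isUnit_det] at h1
  exact h1.ne_zero

/-! ### Unstable flags -/

namespace Flag3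

variable {F : Flag3} {g : SL3} {l m n : ℝ} {x y : Fin 3 → ℝ}

theorem IsUnstable.mem_span (hF : F.IsUnstable g l m) (hx : F.IsFrame x y) {v : Fin 3 → ℝ}
    (hv0 : v ≠ 0) (hv : g • v = l • v) : ∃ k : ℝ, k ≠ 0 ∧ x = k • v := by
  have h1 : v ∈ Submodule.span ℝ {x} := by
    rw [hx.1, hF.1, Module.End.mem_eigenspace_iff]
    exact hv
  obtain ⟨k, rfl⟩ := Submodule.mem_span_singleton.1 h1
  have hk : k ≠ 0 := by
    rintro rfl
    simp at hv0
  exact ⟨k⁻¹, inv_ne_zero hk, by rw [smul_smul, inv_mul_cancel₀ hk, one_smul]⟩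

/-- On the invariant plane `g` has determinant `l * m`, and the full determinant is `l * m * n = 1`;
hence the form cutting out the plane has eigenvalue `n`. -/
theorem IsUnstable.wedge_smul (hF : F.IsUnstable g l m) (hx : F.IsFrame x y)
    (hg : HasEigenvalues g l m n) (v : Fin 3 → ℝ) : wedge x y (g • v) = n * wedge x y v := by
  have hgx : g • x = l • x := by
    have : x ∈ F.line := hx.1 ▸ Submodule.mem_span_singleton_self x
    rw [hF.1, Module.End.mem_eigenspace_iff] at this
    exact this
  have hy : y ∈ F.plane := hx.2 ▸ Submodule.subset_span (by simp)
  rw [hF.2, ← hx.1, Submodule.mem_sup] at hy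
  obtain ⟨w, hw, u, hu, rfl⟩ := hy
  obtain ⟨α, rfl⟩ := Submodule.mem_span_singleton.1 hw
  rw [Module.End.mem_eigenspace_iff] at hu
  replace hu : g • u = m • u := hu
  -- Modulo `x`, the vector `y` may be replaced by its component in the `m`-eigenspace.
  have hred (v : Fin 3 → ℝ) : wedge x (α • x + u) v = wedge x u v := by
    rw [wedge_cycle, wedge_cycle, wedge_add, _root_.wedge_smul, wedge_self_right, mul_zero,
      zero_add, ← wedge_cycle, ← wedge_cycle, ← wedge_cycle, ← wedge_cycle]
  rw [hred, hred]
  have h1 := wedge_SL3_smul g x u v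
  rw [hgx, hu, wedge_smul_left, wedge_smul_middle] at h1
  rw [← h1]
  linear_combination -(wedge x u (g • v)) * hg.mul_eq_one

/-- The coefficients of this form are those of the cross product of the independent vectors `x` and
`y`. -/
theorem IsFrame.exists_wedge_ne_zero (hx : F.IsFrame x y) : ∃ v, wedge x y v ≠ 0 := by
  have hli : LinearIndependent ℝ ![x, y] := by
    rw [linearIndependent_iff_card_eq_finrank_span, Set.finrank, Matrix.range_cons,
      Matrix.range_cons, Matrix.range_empty, Set.union_empty, Set.singleton_union, hx.2,
      F.finrank_plane]
    simp
  have h := crossProduct_ne_zero_iff_linearIndependent.2 hli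
  contrapose! h
  have h0 := h (Pi.single 0 1)
  have h1 := h (Pi.single 1 1)
  have h2 := h (Pi.single 2 1)
  simp [wedge, Matrix.det_fin_three] at h0 h1 h2
  rw [cross_apply]
  ext j
  fin_cases j <;> simp <;> linarith

end Flag3

/-! ### Normalized coordinates -/

/-- Real cube roots of either sign allow a 3 × 3 matrix to be scaled to determinant 1. -/
theorem exists_pow_three_eq (d : ℝ) : ∃ r : ℝ, r ^ 3 = d := by
  have h (d : ℝ) (hd : 0 ≤ d) : ∃ r : ℝ, r ^ 3 = d :=
    ⟨d ^ (1 / 3 : ℝ), by rw [← Real.rpow_natCast, ← Real.rpow_mul hd]; norm_num⟩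
  rcases le_total 0 d with hd | hd
  · exact h d hd
  · obtain ⟨r, hr⟩ := h (-d) (by linarith)
    exact ⟨-r, by rw [Odd.neg_pow (by decide), hr, neg_neg]⟩

/-- A basis of `ℝ³` is carried to a multiple of the standard basis by a matrix in `SL₃(ℝ)`. -/
theorem exists_SL3_smul_eq {E : Fin 3 → Fin 3 → ℝ} (h : LinearIndependent ℝ E) :
    ∃ (g : SL3) (k : ℝ), k ≠ 0 ∧ ∀ i, g • E i = k • (Pi.single i 1 : Fin 3 → ℝ) := by
  let B : Matrix (Fin 3) (Fin 3) ℝ := (Matrix.of E).transpose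
  have hdet : B.det ≠ 0 := by
    have h1 : LinearIndependent ℝ (Matrix.of E).row := h
    rw [Matrix.linearIndependent_rows_iff_isUnit, Matrix.isUnit_iff_isUnit_det] at h1
    rw [Matrix.det_transpose]
    exact h1.ne_zero
  obtain ⟨r, hr⟩ := exists_pow_three_eq B.det
  have hr0 : r ≠ 0 := by
    rintro rfl
    exact hdet (by rw [← hr]; norm_num)
  have hg : (r • B⁻¹).det = 1 := by
    rw [Matrix.det_smul, Matrix.det_nonsing_inv, Ring.inverse_eq_inv', ← hr]
    simp [hr0]
  refine ⟨⟨r • B⁻¹, hg⟩, r, hr0, fun i => ?_⟩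
  have h1 : E i = B.mulVec (Pi.single i 1) := by
    rw [Matrix.mulVec_single_one]
    rfl
  change (r • B⁻¹).mulVec (E i) = _
  rw [h1, Matrix.smul_mulVec, Matrix.mulVec_mulVec,
    Matrix.nonsing_inv_mul _ (isUnit_iff_ne_zero.2 hdet), Matrix.one_mulVec]

/-- Goldman's equations do not depend on the normalization of the coordinates. -/
theorem areInternalParameters_iff {Δplus : ProjTriangle} {Δ : Fin 3 → ProjTriangle}
    {lam tau : Fin 3 → ℝ} {E Q : Fin 3 → Fin 3 → ℝ} (hE : LinearIndependent ℝ E)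
    {a b : Fin 3 → ℝ} (ha : ∀ i, 0 < a i) (hb : ∀ i, 0 < b i)
    (hQ : ∀ i, Q i = a i • E (i + 1) - E i + b i • E (i - 1))
    (hEΔ : ∀ i, IsHomCoord (E i) (Δplus.vertex i)) (hQΔ : ∀ i, IsHomCoord (Q i) ((Δ i).vertex i))
    {s t : ℝ} :
    AreInternalParameters Δplus Δ lam tau s t ↔
      0 < s ∧ 0 < t ∧ t = b 1 * b 2 / a 2 ∧ ∀ i, b (i - 1) * a (i + 1) =
        1 + tau i * √(lam i * lam (i - 1) / lam (i + 1)) * s + lam (i - 1) / lam (i + 1) * s ^ 2 := by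
  have hQ0 : Q 0 = a 0 • E 1 - E 0 + b 0 • E 2 := hQ 0
  have hQ1 : Q 1 = a 1 • E 2 - E 1 + b 1 • E 0 := hQ 1
  have hQ2 : Q 2 = a 2 • E 0 - E 2 + b 2 • E 1 := hQ 2
  have hall : (∀ i, b (i - 1) * a (i + 1) =
        1 + tau i * √(lam i * lam (i - 1) / lam (i + 1)) * s + lam (i - 1) / lam (i + 1) * s ^ 2) ↔
      b 2 * a 1 = 1 + tau 0 * √(lam 0 * lam 2 / lam 1) * s + lam 2 / lam 1 * s ^ 2 ∧
      a 2 * b 0 = 1 + tau 1 * √(lam 0 * lam 1 / lam 2) * s + lam 0 / lam 2 * s ^ 2 ∧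
      b 1 * a 0 = 1 + tau 2 * √(lam 1 * lam 2 / lam 0) * s + lam 1 / lam 0 * s ^ 2 := by
    rw [Fin.forall_fin_succ, Fin.forall_fin_succ, Fin.forall_fin_succ, mul_comm (a 2),
      mul_comm (lam 0) (lam 1), mul_comm (lam 1) (lam 2)]
    simp only [IsEmpty.forall_iff, and_true]
    rfl
  rw [hall]
  constructor
  · rintro ⟨g, b₁, c₁, a₂, c₂, a₃, b₃, hb₁, hc₁, ha₂, hc₂, ha₃, hb₃, h0, h1, h2, k0, k1, k2,
      hs, ht, htt, e0, e1, e2⟩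
    obtain ⟨r0, hr0, h0⟩ := ((hEΔ 0).mapsTo g).exists_smul_eq h0
    obtain ⟨r1, hr1, h1⟩ := ((hEΔ 1).mapsTo g).exists_smul_eq h1
    obtain ⟨r2, hr2, h2⟩ := ((hEΔ 2).mapsTo g).exists_smul_eq h2
    obtain ⟨q0, hq0, k0⟩ := ((hQΔ 0).mapsTo g).exists_smul_eq k0
    obtain ⟨q1, hq1, k1⟩ := ((hQΔ 1).mapsTo g).exists_smul_eq k1
    obtain ⟨q2, hq2, k2⟩ := ((hQΔ 2).mapsTo g).exists_smul_eq k2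
    rw [hQ0, smul_add, smul_sub, smul_comm g, smul_comm g, h0, h1, h2] at k0
    rw [hQ1, smul_add, smul_sub, smul_comm g, smul_comm g, h0, h1, h2] at k1
    rw [hQ2, smul_add, smul_sub, smul_comm g, smul_comm g, h0, h1, h2] at k2
    have k00 := congrFun k0 0
    have k01 := congrFun k0 1
    have k02 := congrFun k0 2
    have k10 := congrFun k1 0
    have k11 := congrFun k1 1
    have k12 := congrFun k1 2
    have k20 := congrFun k2 0
    have k21 := congrFun k2 1
    have k22 := congrFun k2 2
    simp at k00 k01 k02 k10 k11 k12 k20 k21 k22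
    subst k00 k11 k22
    -- The remaining freedom is a diagonal rescaling; the three products and the quotient defining t
    -- are invariant under it.
    have hb₁' : b₁ = a 0 * r1 / r0 := by field_simp; linarith
    have hc₁' : c₁ = b 0 * r2 / r0 := by field_simp; linarith
    have ha₂' : a₂ = b 1 * r0 / r1 := by field_simp; linarith
    have hc₂' : c₂ = a 1 * r2 / r1 := by field_simp; linarith
    have ha₃' : a₃ = a 2 * r0 / r2 := by field_simp; linarith
    have hb₃' : b₃ = b 2 * r1 / r2 := by field_simp; linarith
    have n2 := (ha 2).ne'
    refine ⟨hs, ht, ?_, ?_, ?_, ?_⟩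
    · rw [htt, ha₂', ha₃', hb₃']
      field_simp
    · rw [← e0, hb₃', hc₂']
      field_simp
    · rw [← e1, ha₃', hc₁']
      field_simp
    · rw [← e2, ha₂', hb₁']
      field_simp
  · rintro ⟨hs, ht, htt, e0, e1, e2⟩
    obtain ⟨g, k, hk, hg⟩ := exists_SL3_smul_eq hE
    have hgE (i : Fin 3) : IsHomCoord (Pi.single i 1) (g • Δplus.vertex i) := by
      have := ((hEΔ i).mapsTo g).rescale (inv_ne_zero hk)
      rwa [hg i, smul_smul, inv_mul_cancel₀ hk, one_smul] at this
    have hgQ (i : Fin 3) := ((hQΔ i).mapsTo g).rescale (inv_ne_zero hk)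
    refine ⟨g, a 0, b 0, b 1, a 1, a 2, b 2, ha 0, hb 0, hb 1, ha 1, ha 2, hb 2, ?_, ?_, ?_,
      ?_, ?_, ?_, hs, ht, htt, e0, e1, e2⟩
    · convert hgE 0 using 1
      ext j
      fin_cases j <;> rfl
    · convert hgE 1 using 1
      ext j
      fin_cases j <;> rfl
    · convert hgE 2 using 1
      ext j
      fin_cases j <;> rfl
    · convert hgQ 0 using 1
      rw [hQ0, smul_add, smul_sub, smul_comm g, smul_comm g, hg, hg, hg]
      ext j
      fin_cases j <;> simp <;> field_simp
    · convert hgQ 1 using 1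
      rw [hQ1, smul_add, smul_sub, smul_comm g, smul_comm g, hg, hg, hg]
      ext j
      fin_cases j <;> simp <;> field_simp
    · convert hgQ 2 using 1
      rw [hQ2, smul_add, smul_sub, smul_comm g, smul_comm g, hg, hg, hg]
      ext j
      fin_cases j <;> simp <;> field_simp

/-! ### Relations between the scale factors β and γ -/

namespace PantsFrame

variable {M : Fin 3 → SL3} {lam mu nu : Fin 3 → ℝ} (P : PantsFrame M lam)

theorem Q_sub (i : Fin 3) :
    P.Q (i - 1) = P.a (i - 1) • P.E i - P.E (i - 1) + P.b (i - 1) • P.E (i + 1) := by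
  rw [P.Q_eq, sub_add_cancel, FinThree.sub_one_sub_one]

theorem Q_add (i : Fin 3) :
    P.Q (i + 1) = P.a (i + 1) • P.E (i - 1) - P.E (i + 1) + P.b (i + 1) • P.E i := by
  rw [P.Q_eq, add_sub_cancel_right, FinThree.add_one_add_one]

theorem E_ne_zero (i : Fin 3) : P.E i ≠ 0 := P.indep.ne_zero i

theorem Q_ne_zero (i : Fin 3) : P.Q i ≠ 0 := by
  intro h
  have := P.smul_E_sub (i + 1)
  rw [add_sub_cancel_right, h, smul_zero, smul_eq_zero_iff_eq] at this
  exact P.E_ne_zero i this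

theorem wedge_E_ne_zero (i : Fin 3) : wedge (P.E (i + 1)) (P.E (i - 1)) (P.E i) ≠ 0 :=
  wedge_ne_zero_of_linearIndependent P.indep (FinThree.sub_one_ne_add_one i).symm (by simp)
    (by simp)

/-- M_i preserves determinants and sends E_i, E_{i−1}, Q_{i+1} to λ_iE_i, β_iQ_{i−1}, γ_iE_{i+1}. By
the normalization −1 in Q, the triples (E_i, E_{i−1}, Q_{i+1}) and (E_i, Q_{i−1}, E_{i+1}) have
equal determinants. -/
theorem mul_beta_mul_gamma (i : Fin 3) : lam i * P.β i * P.γ i = 1 := by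
  have h := wedge_SL3_smul (M i) (P.E i) (P.E (i - 1)) (P.Q (i + 1))
  rw [P.smul_E, P.smul_E_sub, P.smul_Q_add, wedge_smul_left, wedge_smul_middle, wedge_smul,
    P.Q_add, wedge_add, wedge_sub, wedge_smul, wedge_smul, wedge_self_left, wedge_self_right,
    wedge_cycle, wedge_cycle, P.Q_sub, wedge_add, wedge_sub, wedge_smul, wedge_smul,
    wedge_self_left, wedge_self_right] at h
  have hw := P.wedge_E_ne_zero i
  rw [← wedge_cycle] at hw
  have hw' : wedge (P.E i) (P.E (i - 1)) (P.E (i + 1)) =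
      -wedge (P.E i) (P.E (i + 1)) (P.E (i - 1)) := by
    rw [wedge_swap, wedge_cycle]
  have hw'' : wedge (P.E (i + 1)) (P.E i) (P.E (i - 1)) =
      -wedge (P.E i) (P.E (i + 1)) (P.E (i - 1)) := wedge_swap _ _ _
  rw [hw', hw''] at h
  refine mul_right_cancel₀ hw ?_
  linear_combination h

/-- Follow E_{i+1} through the relation: M_{i−1} sends it to β_{i−1}Q_{i+1}, M_i returns it to its
line with factor γ_i, and M_{i+1} scales it by λ_{i+1}. -/
theorem lam_mul_gamma_mul_beta {i : Fin 3} (h : M (i + 1) * M i * M (i - 1) = 1) :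
    lam (i + 1) * P.γ i * P.β (i - 1) = 1 := by
  have h1 := P.smul_E_sub (i - 1)
  rw [FinThree.sub_one_sub_one] at h1
  have h2 : (M (i + 1) * M i * M (i - 1)) • P.E (i + 1) = P.E (i + 1) := by rw [h, one_smul]
  rw [mul_smul, mul_smul, h1, smul_comm (M i), P.smul_Q_add, smul_comm (M (i + 1)),
    smul_comm (M (i + 1)), P.smul_E, smul_smul, smul_smul] at h2
  have h3 := smul_left_injective ℝ (P.E_ne_zero (i + 1)) (h2.trans (one_smul ℝ _).symm)
  linear_combination h3

end PantsFrame

/-- A `PantsFrame` together with unstable flags of the boundary monodromies, framed by vectors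
`x i`, `y i`, and vectors `x' i` in the lines of the unstable flags at the third vertices. -/
structure PantsFrame.Flags {M : Fin 3 → SL3} {lam : Fin 3 → ℝ} (P : PantsFrame M lam)
    (nu : Fin 3 → ℝ) (x y x' : Fin 3 → Fin 3 → ℝ) : Prop where
  nu_pos : ∀ i, 0 < nu i
  x_eq : ∀ i, ∃ k : ℝ, k ≠ 0 ∧ x i = k • P.E i
  x'_eq : ∀ i, ∃ k : ℝ, k ≠ 0 ∧ x' i = k • P.Q i
  wedge_smul : ∀ i v, wedge (x i) (y i) (M i • v) = nu i * wedge (x i) (y i) v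
  exists_ne_zero : ∀ i, ∃ v, wedge (x i) (y i) v ≠ 0

/-! ### Fock–Goncharov ratios in terms of β, γ and ν -/

namespace PantsFrame.Flags

variable {M : Fin 3 → SL3} {lam nu : Fin 3 → ℝ} {P : PantsFrame M lam}
  {x y x' : Fin 3 → Fin 3 → ℝ}

theorem wedge_E_self (h : P.Flags nu x y x') (i : Fin 3) : wedge (x i) (y i) (P.E i) = 0 := by
  obtain ⟨k, hk0, hk⟩ := h.x_eq i
  have h1 := wedge_self_left (x i) (y i)
  rw [hk, _root_.wedge_smul, ← hk] at h1
  exact (mul_eq_zero.1 h1).resolve_left hk0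

theorem wedge_Q_add (h : P.Flags nu x y x') (i : Fin 3) :
    wedge (x i) (y i) (P.Q (i + 1)) = P.γ i / nu i * wedge (x i) (y i) (P.E (i + 1)) := by
  have h1 := h.wedge_smul i (P.Q (i + 1))
  rw [P.smul_Q_add, _root_.wedge_smul] at h1
  have := (h.nu_pos i).ne'
  field_simp
  linarith

theorem wedge_Q_sub (h : P.Flags nu x y x') (i : Fin 3) :
    wedge (x i) (y i) (P.Q (i - 1)) = nu i / P.β i * wedge (x i) (y i) (P.E (i - 1)) := by
  have h1 := h.wedge_smul i (P.E (i - 1))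
  rw [P.smul_E_sub, _root_.wedge_smul] at h1
  have := (P.β_pos i).ne'
  field_simp
  linarith

/-- The form is evaluated at Q_{i+1} twice: through the eigenvalue relation and through coordinates,
where the E_i term drops out. `wedge_E_sub` does the same at Q_{i−1}. -/
theorem wedge_E_add (h : P.Flags nu x y x') (i : Fin 3) :
    wedge (x i) (y i) (P.E (i + 1)) * (1 + P.γ i / nu i) =
      P.a (i + 1) * wedge (x i) (y i) (P.E (i - 1)) := by
  have h1 := h.wedge_Q_add i
  rw [P.Q_add, wedge_add, wedge_sub, _root_.wedge_smul, _root_.wedge_smul, h.wedge_E_self] at h1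
  linear_combination -h1

theorem wedge_E_sub (h : P.Flags nu x y x') (i : Fin 3) :
    wedge (x i) (y i) (P.E (i - 1)) * (1 + nu i / P.β i) =
      P.b (i - 1) * wedge (x i) (y i) (P.E (i + 1)) := by
  have h1 := h.wedge_Q_sub i
  rw [P.Q_sub, wedge_add, wedge_sub, _root_.wedge_smul, _root_.wedge_smul, h.wedge_E_self] at h1
  linear_combination -h1

/-- Otherwise the form would vanish at E_{i−1} too, hence on the whole basis. -/
theorem wedge_E_add_ne_zero (h : P.Flags nu x y x') (i : Fin 3) :
    wedge (x i) (y i) (P.E (i + 1)) ≠ 0 := by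
  intro h0
  have h1 := h.wedge_E_add i
  rw [h0, zero_mul, eq_comm, mul_eq_zero, or_iff_right (P.a_pos _).ne'] at h1
  obtain ⟨v, hv⟩ := h.exists_ne_zero i
  obtain ⟨c, hc⟩ := ProjTriangle.exists_coord ⟨P.E, P.indep⟩ v
  refine hv ?_
  rw [hc, sum_fin_three_eq i]
  simp only [wedge_add, _root_.wedge_smul, h0, h1, h.wedge_E_self, mul_zero, add_zero]

theorem wedge_E_sub_ne_zero (h : P.Flags nu x y x') (i : Fin 3) :
    wedge (x i) (y i) (P.E (i - 1)) ≠ 0 := by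
  intro h0
  have h1 := h.wedge_E_sub i
  rw [h0, zero_mul, eq_comm, mul_eq_zero, or_iff_right (P.b_pos _).ne'] at h1
  exact h.wedge_E_add_ne_zero i h1

/-- The factors of the triple ratio. -/
theorem ratio_eq (h : P.Flags nu x y x') (i : Fin 3) :
    wedge (x i) (y i) (P.E (i + 1)) / wedge (x i) (y i) (P.E (i - 1)) =
      P.a (i + 1) / (1 + P.γ i / nu i) := by
  have h1 : 0 < 1 + P.γ i / nu i := by
    have := div_pos (P.γ_pos i) (h.nu_pos i)
    linarith
  rw [div_eq_div_iff (h.wedge_E_sub_ne_zero i) h1.ne', h.wedge_E_add]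

theorem ratio_eq' (h : P.Flags nu x y x') (i : Fin 3) :
    wedge (x i) (y i) (P.E (i + 1)) / wedge (x i) (y i) (P.E (i - 1)) =
      (1 + nu i / P.β i) / P.b (i - 1) := by
  rw [div_eq_div_iff (h.wedge_E_sub_ne_zero i) (P.b_pos _).ne', mul_comm (1 + _), h.wedge_E_sub,
    mul_comm]

theorem b_mul_a (h : P.Flags nu x y x') (i : Fin 3) :
    P.b (i - 1) * P.a (i + 1) = (1 + P.γ i / nu i) * (1 + nu i / P.β i) := by
  have h1 : 0 < 1 + P.γ i / nu i := by
    have := div_pos (P.γ_pos i) (h.nu_pos i)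
    linarith
  have h2 := (h.ratio_eq i).symm.trans (h.ratio_eq' i)
  rw [div_eq_div_iff h1.ne' (P.b_pos _).ne'] at h2
  linear_combination h2

/-- Each line vector occurs once in the numerator and once in the denominator, so the scalings
cancel. -/
theorem tripleRatio_eq (h : P.Flags nu x y x') :
    tripleRatio x y = ∏ i, wedge (x i) (y i) (P.E (i + 1)) / wedge (x i) (y i) (P.E (i - 1)) := by
  choose k hk hx using h.x_eq
  have a0 := h.wedge_E_add_ne_zero 0
  have a1 := h.wedge_E_add_ne_zero 1
  have a2 := h.wedge_E_add_ne_zero 2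
  have b0 := h.wedge_E_sub_ne_zero 0
  have b1 := h.wedge_E_sub_ne_zero 1
  have b2 := h.wedge_E_sub_ne_zero 2
  have k0 := hk 0
  have k1 := hk 1
  have k2 := hk 2
  have hw (i j : Fin 3) : wedge (x i) (y i) (x j) = k j * wedge (x i) (y i) (P.E j) := by
    rw [← _root_.wedge_smul, ← hx j]
  rw [Fin.prod_univ_three, tripleRatio, wedge_cycle (x 1) (x 2) (y 2), wedge_cycle (x 0) (x 2) (y 2),
    wedge_cycle (x 0) (x 1) (y 1)]
  simp only [hw]
  change wedge (x 0) (y 0) (P.E 1) ≠ 0 at a0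
  change wedge (x 1) (y 1) (P.E 2) ≠ 0 at a1
  change wedge (x 2) (y 2) (P.E 0) ≠ 0 at a2
  change wedge (x 0) (y 0) (P.E 2) ≠ 0 at b0
  change wedge (x 1) (y 1) (P.E 0) ≠ 0 at b1
  change wedge (x 2) (y 2) (P.E 1) ≠ 0 at b2
  change _ = wedge (x 0) (y 0) (P.E 1) / wedge (x 0) (y 0) (P.E 2) *
    (wedge (x 1) (y 1) (P.E 2) / wedge (x 1) (y 1) (P.E 0)) *
    (wedge (x 2) (y 2) (P.E 0) / wedge (x 2) (y 2) (P.E 1))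
  field_simp

theorem wedge_div_wedge (h : P.Flags nu x y x') (i : Fin 3) : ∃ k k' : ℝ, k ≠ 0 ∧ k' ≠ 0 ∧
    x i = k • P.E i ∧ x' i = k' • P.Q i ∧
    wedge (x (i + 1)) (x (i - 1)) (x i) / wedge (x (i + 1)) (x (i - 1)) (x' i) = -(k / k') := by
  obtain ⟨k, hk, hx⟩ := h.x_eq i
  obtain ⟨k', hk', hx'⟩ := h.x'_eq i
  obtain ⟨l, hl, hxl⟩ := h.x_eq (i + 1)
  obtain ⟨m, hm, hxm⟩ := h.x_eq (i - 1)
  have hw := P.wedge_E_ne_zero i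
  have hW : wedge (x (i + 1)) (x (i - 1)) (x i) =
      l * m * k * wedge (P.E (i + 1)) (P.E (i - 1)) (P.E i) := by
    rw [hx, hxl, hxm, wedge_smul_left, wedge_smul_middle, _root_.wedge_smul]
    ring
  have hW' : wedge (x (i + 1)) (x (i - 1)) (x' i) =
      -(l * m * k' * wedge (P.E (i + 1)) (P.E (i - 1)) (P.E i)) := by
    rw [hx', hxl, hxm, wedge_smul_left, wedge_smul_middle, _root_.wedge_smul, P.Q_eq, wedge_add,
      wedge_sub, _root_.wedge_smul, _root_.wedge_smul, wedge_self_left, wedge_self_right]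
    ring
  refine ⟨k, k', hk, hk', hx, hx', ?_⟩
  rw [hW, hW']
  field_simp

theorem shearRatio₁_eq (h : P.Flags nu x y x') (i : Fin 3) :
    shearRatio₁ x y x' i = P.γ (i - 1) / nu (i - 1) := by
  obtain ⟨k, k', hk, hk', hx, hx', hr⟩ := h.wedge_div_wedge i
  have h1 := h.wedge_Q_add (i - 1)
  have h2 := h.wedge_E_add_ne_zero (i - 1)
  rw [sub_add_cancel] at h1 h2
  rw [shearRatio₁, hr, hx, hx', _root_.wedge_smul, _root_.wedge_smul, h1]
  field_simp

theorem shearRatio₂_eq (h : P.Flags nu x y x') (i : Fin 3) :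
    shearRatio₂ x y x' i = P.β (i + 1) / nu (i + 1) := by
  obtain ⟨k, k', hk, hk', hx, hx', hr⟩ := h.wedge_div_wedge i
  have h1 := h.wedge_Q_sub (i + 1)
  have h2 := h.wedge_E_sub_ne_zero (i + 1)
  have h3 := (P.β_pos (i + 1)).ne'
  have h4 := (h.nu_pos (i + 1)).ne'
  rw [add_sub_cancel_right] at h1 h2
  rw [shearRatio₂, ← inv_div, hr, hx, hx', _root_.wedge_smul, _root_.wedge_smul, h1]
  field_simp

end PantsFrame.Flags

/-! ### The internal parameters -/

/-- The quadratic polynomial in Goldman's equations is injective on positive numbers. -/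
theorem one_add_mul_add_mul_sq_inj {A B u v : ℝ} (hA : 0 < A) (hB : 0 < B) (hu : 0 < u)
    (hv : 0 < v) : 1 + A * u + B * u ^ 2 = 1 + A * v + B * v ^ 2 ↔ u = v := by
  refine ⟨fun h => ?_, fun h => by rw [h]⟩
  have h1 : (u - v) * (A + B * (u + v)) = 0 := by linear_combination h
  have h2 : 0 < A + B * (u + v) := by positivity
  linarith [(mul_eq_zero.1 h1).resolve_right h2.ne']

theorem eq_of_pow_six_eq {u v : ℝ} (hu : 0 < u) (hv : 0 < v) (h : u ^ 6 = v ^ 6) : u = v :=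
  (pow_left_inj₀ hu.le hv.le (by norm_num)).1 h

/-- The relation between the parameter `s` and the numbers `β i`. -/
theorem inv_beta_eq {l₀ l₁ l₂ β₀ β₁ β₂ γ₀ γ₁ γ₂ s : ℝ} (hl₀ : 0 < l₀) (hl₁ : 0 < l₁) (hl₂ : 0 < l₂)
    (hβ₀ : 0 < β₀) (hs : 0 < s)
    (h₀ : l₀ * β₀ * γ₀ = 1) (h₁ : l₁ * β₁ * γ₁ = 1) (h₂ : l₂ * β₂ * γ₂ = 1)
    (h₂₀ : l₁ * γ₀ * β₂ = 1) (h₀₁ : l₂ * γ₁ * β₀ = 1)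
    (h6 : s ^ 6 = γ₀ / β₀ * (γ₁ / β₁) * (γ₂ / β₂)) : 1 / β₀ = √(l₀ * l₂ / l₁) * s := by
  -- The five relations express every other β and γ through β₀; substituting in `h6`, s⁶ becomes
  -- (l₁/(l₀l₂))³ β₀⁻⁶.
  refine eq_of_pow_six_eq (by positivity) (by positivity) ?_
  have hγ₀ : γ₀ = 1 / (l₀ * β₀) := by
    field_simp
    linarith
  have hγ₁ : γ₁ = 1 / (l₂ * β₀) := by
    field_simp
    linarith
  have hβ₂' : β₂ = l₀ * β₀ / l₁ := by
    rw [hγ₀] at h₂₀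
    field_simp at h₂₀ ⊢
    linarith
  have hβ₁' : β₁ = l₂ * β₀ / l₁ := by
    rw [hγ₁] at h₁
    field_simp at h₁ ⊢
    linarith
  have hγ₂ : γ₂ = l₁ / (l₂ * l₀ * β₀) := by
    rw [hβ₂'] at h₂
    field_simp at h₂ ⊢
    linarith
  have hsq : √(l₀ * l₂ / l₁) ^ 6 = (l₀ * l₂ / l₁) ^ 3 := by
    rw [show 6 = 2 * 3 by norm_num, pow_mul, Real.sq_sqrt (by positivity)]
  rw [mul_pow, hsq, h6, hγ₀, hγ₁, hγ₂, hβ₁', hβ₂']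
  field_simp

/-! ### Positivity and Goldman's equations -/

namespace PantsFrame.Flags

variable {M : Fin 3 → SL3} {lam nu : Fin 3 → ℝ} {P : PantsFrame M lam}
  {x y x' : Fin 3 → Fin 3 → ℝ}

theorem shearRatio₁_pos (h : P.Flags nu x y x') (i : Fin 3) : 0 < shearRatio₁ x y x' i := by
  rw [h.shearRatio₁_eq]
  exact div_pos (P.γ_pos _) (h.nu_pos _)

theorem shearRatio₂_pos (h : P.Flags nu x y x') (i : Fin 3) : 0 < shearRatio₂ x y x' i := by
  rw [h.shearRatio₂_eq]
  exact div_pos (P.β_pos _) (h.nu_pos _)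

theorem tripleRatio_pos (h : P.Flags nu x y x') : 0 < tripleRatio x y := by
  rw [h.tripleRatio_eq]
  refine Finset.prod_pos fun i _ => ?_
  rw [h.ratio_eq]
  have := div_pos (P.γ_pos i) (h.nu_pos i)
  have := P.a_pos (i + 1)
  positivity

theorem exp_pow_six (h : P.Flags nu x y x') :
    Real.exp ((1 / 6) * (sigma₁ x y x' 0 + sigma₁ x y x' 1 + sigma₁ x y x' 2
      - sigma₂ x y x' 0 - sigma₂ x y x' 1 - sigma₂ x y x' 2)) ^ 6 = ∏ i, P.γ i / P.β i := by
  rw [← Real.exp_nat_mul]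
  push_cast
  rw [← mul_assoc, show (6 : ℝ) * (1 / 6) = 1 by norm_num, one_mul]
  simp only [Real.exp_sub, Real.exp_add, sigma₁, sigma₂, Real.exp_log (h.shearRatio₁_pos _),
    Real.exp_log (h.shearRatio₂_pos _)]
  simp only [h.shearRatio₁_eq, h.shearRatio₂_eq]
  rw [Fin.prod_univ_three]
  have b0 := (P.β_pos 0).ne'
  have b1 := (P.β_pos 1).ne'
  have b2 := (P.β_pos 2).ne'
  have n0 := (h.nu_pos 0).ne'
  have n1 := (h.nu_pos 1).ne'
  have n2 := (h.nu_pos 2).ne'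
  change P.γ 2 / nu 2 * (P.γ 0 / nu 0) * (P.γ 1 / nu 1) / (P.β 1 / nu 1) / (P.β 2 / nu 2) /
    (P.β 0 / nu 0) = _
  field_simp

theorem exp_neg_tau111_mul (h : P.Flags nu x y x') :
    Real.exp (-tau111 x y) * (Real.exp (-sigma₂ x y x' 1) + 1) *
      (Real.exp (-sigma₂ x y x' 2) + 1) * (Real.exp (sigma₁ x y x' 2) + 1)⁻¹ =
      P.b 1 * P.b 2 / P.a 2 := by
  -- Of the two expressions for each ratio, those are taken whose brackets cancel against the three
  -- shear factors in the formula for t.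
  have r0 := h.ratio_eq' 0
  have r1 := h.ratio_eq 1
  have r2 := h.ratio_eq' 2
  change _ = _ / P.b 2 at r0
  change _ = P.a 2 / _ at r1
  change _ = _ / P.b 1 at r2
  simp only [Real.exp_neg, tau111, sigma₁, sigma₂, Real.exp_log (h.shearRatio₁_pos _),
    Real.exp_log (h.shearRatio₂_pos _), Real.exp_log h.tripleRatio_pos]
  simp only [h.shearRatio₁_eq, h.shearRatio₂_eq, h.tripleRatio_eq, Fin.prod_univ_three, r0, r1, r2]
  change _ * ((P.β 2 / nu 2)⁻¹ + 1) * ((P.β 0 / nu 0)⁻¹ + 1) * (P.γ 1 / nu 1 + 1)⁻¹ = _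
  have := P.a_pos 2
  have := P.b_pos 1
  have := P.b_pos 2
  have := P.β_pos 0
  have := P.β_pos 2
  have := P.γ_pos 1
  have := h.nu_pos 0
  have := h.nu_pos 1
  have := h.nu_pos 2
  rw [inv_div, inv_div, add_comm _ (1 : ℝ), add_comm _ (1 : ℝ), add_comm _ (1 : ℝ)]
  have e0 : 0 < 1 + nu 0 / P.β 0 := by positivity
  have e1 : 0 < 1 + P.γ 1 / nu 1 := by positivity
  have e2 : 0 < 1 + nu 2 / P.β 2 := by positivity
  generalize 1 + nu 0 / P.β 0 = u at *
  generalize 1 + P.γ 1 / nu 1 = v at *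
  generalize 1 + nu 2 / P.β 2 = w at *
  field_simp

/-- Goldman's equations in terms of the numbers `β i`. -/
theorem equation_iff (h : P.Flags nu x y x') {mu : Fin 3 → ℝ}
    (hev : ∀ i, HasEigenvalues (M i) (lam i) (mu i) (nu i))
    (hM : ∀ i, M (i + 1) * M i * M (i - 1) = 1) {s₀ s : ℝ} (hs₀ : 0 < s₀)
    (h6 : s₀ ^ 6 = ∏ i, P.γ i / P.β i) (hs : 0 < s) (i : Fin 3) :
    P.b (i - 1) * P.a (i + 1) = 1 + (mu i + nu i) * √(lam i * lam (i - 1) / lam (i + 1)) * s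
      + lam (i - 1) / lam (i + 1) * s ^ 2 ↔ s = s₀ := by
  have hl (i : Fin 3) : 0 < lam i := (hev i).1
  have hm : 0 < mu i := (hl i).trans (hev i).2.1
  have hn := h.nu_pos i
  have hβ := P.β_pos i
  have h1 := P.mul_beta_mul_gamma
  have h2 (i : Fin 3) := P.lam_mul_gamma_mul_beta (hM i)
  have h6' : s₀ ^ 6 = P.γ i / P.β i * (P.γ (i + 1) / P.β (i + 1)) * (P.γ (i - 1) / P.β (i - 1)) := by
    -- The rotated sum over `Fin 3`, transported to products through `Additive`.
    have hperm : ∏ j, P.γ j / P.β j = P.γ i / P.β i * (P.γ (i + 1) / P.β (i + 1)) *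
        (P.γ (i - 1) / P.β (i - 1)) := by
      have := sum_fin_three_eq i (fun j => Additive.ofMul (P.γ j / P.β j))
      exact (congrArg Additive.toMul this).trans (by
        rw [toMul_add, toMul_add]
        exact congrArg (· * _) (mul_comm _ _))
    rw [h6, hperm]
  have h3 := h2 (i + 1)
  rw [FinThree.add_one_add_one, add_sub_cancel_right] at h3
  have hu := inv_beta_eq (hl i) (hl (i + 1)) (hl (i - 1)) hβ hs₀ (h1 i) (h1 (i + 1))
    (h1 (i - 1)) (h2 i) h3 h6'
  set c := √(lam i * lam (i - 1) / lam (i + 1)) with hc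
  have hl0 := hl i
  have hl1 := hl (i + 1)
  have hl2 := hl (i - 1)
  have hcpos : 0 < c := by positivity
  have hcsq : c ^ 2 = lam i * lam (i - 1) / lam (i + 1) := Real.sq_sqrt (by positivity)
  have hγ : P.γ i = 1 / (lam i * P.β i) := by
    have := h1 i
    field_simp
    linarith
  have hnu : lam i * mu i * nu i = 1 := (hev i).mul_eq_one
  -- Here γ_i = μ_iν_i/β_i, so the product is (1 + μ_i/β_i)(1 + ν_i/β_i), with 1/β_i = c s₀.
  have hlhs : P.b (i - 1) * P.a (i + 1) =
      1 + (mu i + nu i) * (c * s₀) + mu i * nu i * (c * s₀) ^ 2 := by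
    rw [h.b_mul_a, ← hu]
    have hγ' : P.γ i = mu i * nu i / P.β i := by
      rw [hγ, ← hnu]
      field_simp
    rw [hγ']
    field_simp
    ring
  -- Since λ_iμ_iν_i = 1, the leading coefficient λ_{i−1}/λ_{i+1} equals μ_iν_i c²; both sides
  -- become the same quadratic, at c s₀ and at c s.
  have hrhs : 1 + (mu i + nu i) * c * s + lam (i - 1) / lam (i + 1) * s ^ 2 =
      1 + (mu i + nu i) * (c * s) + mu i * nu i * (c * s) ^ 2 := by
    rw [mul_pow, hcsq]
    have : lam (i - 1) / lam (i + 1) = mu i * nu i * (lam i * lam (i - 1) / lam (i + 1)) := by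
      field_simp
      linear_combination -hnu
    rw [this]
    ring
  rw [hlhs, hrhs, one_add_mul_add_mul_sq_inj (by positivity) (by positivity) (by positivity)
    (by positivity), eq_comm, mul_right_inj' hcpos.ne']

end PantsFrame.Flags

/-- The interior of the pair of pants is `Pants = ℂ ∖ {0, 1}`, with universal cover `p : X → Pants`
and a convex projective structure `π` with developing map and monodromy `D`. The monodromy of the
boundary elements `A i` has eigenvalues `0 < lam i < mu i < nu i`. The third vertex of the lift of
`T₋` adjacent to `T̃₊` along the `i`-th side is fixed by the boundary element
`A (i + 1) * A i * (A (i + 1))⁻¹`; its unstable flag is `F' i`. -/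
theorem proposition2 {X : Type*} [TopologicalSpace X] [SimplyConnectedSpace X]
    (p : X → Pants) (hp : IsCoveringMap p)
    (π : ProjectiveStructure Pants) (D : Development π p) (hD : D.IsConvex)
    (L : TriangleLifts p) (A : Fin 3 → Deck p) (hA : L.AreBoundaryElements A)
    (lam mu nu : Fin 3 → ℝ) (hev : ∀ i, HasEigenvalues (D.ρ (A i)) (lam i) (mu i) (nu i))
    (G : GoldmanPosition D L A lam)
    (F F' : Fin 3 → Flag3)
    (hF : ∀ i, (F i).IsUnstable (D.ρ (A i)) (lam i) (mu i))
    (hF' : ∀ i, (F' i).IsUnstable (D.ρ (A (i + 1) * A i * (A (i + 1))⁻¹)) (lam i) (mu i))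
    (x y x' y' : Fin 3 → (Fin 3 → ℝ))
    (hx : ∀ i, (F i).IsFrame (x i) (y i)) (hx' : ∀ i, (F' i).IsFrame (x' i) (y' i)) :
    (0 < tripleRatio x y ∧ ∀ i, 0 < shearRatio₁ x y x' i ∧ 0 < shearRatio₂ x y x' i) ∧
    ∀ s t : ℝ,
      AreInternalParameters G.Δplus G.Δ lam (fun i => mu i + nu i) s t ↔
        s = Real.exp ((1 / 6) *
              (sigma₁ x y x' 0 + sigma₁ x y x' 1 + sigma₁ x y x' 2
                - sigma₂ x y x' 0 - sigma₂ x y x' 1 - sigma₂ x y x' 2)) ∧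
        t = Real.exp (-tau111 x y) * (Real.exp (-sigma₂ x y x' 1) + 1) *
              (Real.exp (-sigma₂ x y x' 2) + 1) * (Real.exp (sigma₁ x y x' 2) + 1)⁻¹ := by
  obtain ⟨P, hPE, hPQ⟩ := G.exists_pantsFrame hp hD hA hev
  have hflags : P.Flags nu x y x' :=
    { nu_pos := fun i => (hev i).1.trans ((hev i).2.1.trans (hev i).2.2.1)
      x_eq := fun i => (hF i).mem_span (hx i) (P.E_ne_zero i) (P.smul_E i)
      x'_eq := fun i => by
        refine (hF' i).mem_span (hx' i) (P.Q_ne_zero i) ?_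
        -- Q_i is proportional to the image of E_i under M_{i+1}, so the conjugate of M_i by M_{i+1}
        -- scales it by λ_i.
        have h1 : D.ρ (A (i + 1)) • P.E i = P.β (i + 1) • P.Q i := by
          have := P.smul_E_sub (i + 1)
          rwa [add_sub_cancel_right] at this
        have h2 : P.Q i = (P.β (i + 1))⁻¹ • D.ρ (A (i + 1)) • P.E i := by
          rw [h1, smul_smul, inv_mul_cancel₀ (P.β_pos _).ne', one_smul]
        rw [h2, map_mul, map_mul, map_inv, mul_smul, mul_smul, smul_comm _ (P.β (i + 1))⁻¹,
          inv_smul_smul, smul_comm _ (P.β (i + 1))⁻¹, P.smul_E, smul_comm _ (P.β (i + 1))⁻¹,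
          smul_comm _ (lam i), smul_comm _ (lam i)]
      wedge_smul := fun i v => (hF i).wedge_smul (hx i) (hev i) v
      exists_ne_zero := fun i => (hx i).exists_wedge_ne_zero }
  have hM (i : Fin 3) : D.ρ (A (i + 1)) * D.ρ (A i) * D.ρ (A (i - 1)) = 1 := by
    rw [← map_mul, ← map_mul, hA.mul_mul_eq_one hp i, map_one]
  refine ⟨⟨hflags.tripleRatio_pos, fun i => ⟨hflags.shearRatio₁_pos i, hflags.shearRatio₂_pos i⟩⟩,
    fun s t => ?_⟩
  rw [areInternalParameters_iff P.indep P.a_pos P.b_pos P.Q_eq hPE hPQ, hflags.exp_neg_tau111_mul]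
  have heq {s : ℝ} (hs : 0 < s) (i : Fin 3) :=
    hflags.equation_iff hev hM (Real.exp_pos _) hflags.exp_pow_six hs i
  constructor
  · rintro ⟨hs, -, ht, h⟩
    exact ⟨(heq hs 0).1 (h 0), ht⟩
  · rintro ⟨hs, ht⟩
    have hs' : 0 < s := hs ▸ Real.exp_pos _
    have := P.a_pos 2
    have := P.b_pos 1
    have := P.b_pos 2
    exact ⟨hs', ht ▸ by positivity, ht, fun i => (heq hs' i).2 hs⟩
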